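/- Let $N\ge 0$ and $n\ge 1$ be integers, let $\mathbb F_N$ be the free group on $u_1,\dots,u_N$, and let $x=\sum_{i=1}^N(u_i+u_i^{-1})\in\mathbb C[\mathbb F_N]$. A word of length $n$ is a string $w=l_1\cdots l_n$ of letters $l_i\in\{u_1^{\pm1},\dots,u_N^{\pm1}\}$, not necessarily reduced; $w$ is reducible to $1$ if successive removal of neighbouring mutually inverse letters leads to the empty word. A word $l_1\cdots l_k$ is cyclically reduced if $l_i\ne l_{i+1}^{-1}$ for $1\le i<k$ and $l_k\neq l_1^{-1}$ (the empty word is cyclically reduced). A cyclic reduction of $w$ is a cyclically reduced word obtained from $w$ by successively removing mutually inverse letters that are neighbours or are the first and the last letter. A non-crossing half-pairing of $[n]=\{1,\dots,n\}$ is a non-crossing partition $\pi$ of $[n]$ with all blocks of size at most $2$ and at least one block of size $1$ (a singleton), such that the partition obtained by merging all singletons into one block is still non-crossing. A point is \emph{out} if it is a singleton, or if it is the point $r$ of a pair $\{r,s\}$ of $\pi$ such that the cyclic interval $[r,s]$ contains no singleton. The point $i$ \emph{covers} $j$ if both are out and either $j=i+1$ (mod $n$) or $\pi$ pairs each point of the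 cyclic interval $[i+1,j-1]$ with another point of that interval. We call $\pi$ \emph{$w$-admissible} if (a) $l_r=l_s^{-1}$ for each pair $\{r,s\}$ of $\pi$; (b) the letters of $w$ at the singletons $i_1<\dots<i_k$ of $\pi$ form a cyclic reduction $l_{i_1}\cdots l_{i_k}$ of $w$; (c) $l_i\ne l_j^{-1}$ whenever $i$ covers $j$. Every word $w$ of length $n$ that is not reducible to $1$ has exactly one $w$-admissible non-crossing half-pairing; its standard cyclic reduction $\widehat w$ is the word $l_{i_1}\cdots l_{i_k}$ of the letters at the singletons of this half-pairing. If $w$ is reducible to $1$, put $\widehat w=1$. In $\mathbb C[\mathbb F_N]$ we have $x^n=\sum_w w$, the sum over all $(2N)^n$ words of length $n$; let $\widehat{x^n}=\sum_w\widehat w$. Let $Q_k\in\mathbb C[\mathbb F_N]$ be the sum of all cyclically reduced words of length $k$. For $1\le k\le n$ with $n-k$ even let \[ s_{n,k}=(2N-1)^{(n-k)/2}\binom{n}{(n-k)/2}, \] and let $s_{n,0}$ be the number of words of length $n$ that are reducible to $1$. Then \[ \widehat{x^n}=Q_n+s_{n,n-2}Q_{n-2}+s_{n,n-4}Q_{n-4}+\cdots+\begin{cases}s_{n,2}Q_2+s_{n,0}\cdot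 1,& n\ge 4\text{ even},\\ s_{n,1}Q_1,& n\ge 3\text{ odd},\end{cases} \] with $\widehat{x}=Q_1$ for $n=1$ and $\widehat{x^2}=Q_2+s_{2,0}\cdot 1$ for $n=2$. -/

import Mathlib

namespace FreeCycle

/-- The letters `u_i` (`(i, true)`) and `u_i⁻¹` (`(i, false)`), as in Mathlib's `FreeGroup`. -/
abbrev Letter (N : ℕ) : Type := Fin N × Bool

/-- The inverse letter. -/
def Letter.inv {N : ℕ} (l : Letter N) : Letter N := (l.1, !l.2)

/-- A word of length `n`: a string of letters which may or may not simplify. -/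
abbrev Word (N n : ℕ) : Type := Fin n → Letter N

/-- A word is reducible to 1 if successive removal of neighbouring inverse letters leads to the
empty word. -/
def ReducibleToOne {N n : ℕ} (w : Word N n) : Prop :=
  FreeGroup.Red (List.ofFn w) []

/-- Removal of one pair of cyclic neighbours which are inverses of each other: either two adjacent
letters, or the first and the last letter. -/
inductive CyclicStep {N : ℕ} : List (Letter N) → List (Letter N) → Prop
  | adjacent {v v' : List (Letter N)} (h : FreeGroup.Red.Step v v') : CyclicStep v v'
  | ends (l : Letter N) (v : List (Letter N)) : CyclicStep (l :: (v ++ [l.inv])) v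

/-- `v'` is a cyclic reduction of `v`. -/
def ReducesCyclically {N : ℕ} (v v' : List (Letter N)) : Prop :=
  FreeGroup.IsCyclicallyReduced v' ∧ Relation.ReflTransGen CyclicStep v v'

section Partitions

variable {n : ℕ}

/-- `{i}` is a block of the partition `π`. -/
def IsSingleton (π : Setoid (Fin n)) (i : Fin n) : Prop :=
  ∀ j, π i j → j = i

/-- The relation `π` on `{1, …, n}` has no crossing. -/
def NonCrossing (π : Setoid (Fin n)) : Prop :=
  ∀ i₁ i₂ i₃ i₄ : Fin n, i₁ < i₂ → i₂ < i₃ → i₃ < i₄ → π i₁ i₃ → π i₂ i₄ → π i₁ i₂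

/-- The partition obtained from `π` by joining all its blocks of size 1 into a single block. -/
def joinSingletons (π : Setoid (Fin n)) : Setoid (Fin n) where
  r i j := π i j ∨ (IsSingleton π i ∧ IsSingleton π j)
  iseqv :=
    { refl := fun i => Or.inl (π.refl' i)
      symm := by
        rintro i j (h | ⟨hi, hj⟩)
        · exact Or.inl (π.symm' h)
        · exact Or.inr ⟨hj, hi⟩
      trans := by
        rintro i j k (h | ⟨hi, hj⟩) (h' | ⟨hj', hk⟩)
        · exact Or.inl (π.trans' h h')
        · have := hj' i (π.symm' h)
          subst this
          exact Or.inr ⟨hj', hk⟩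
        · have := hj k h'
          subst this
          exact Or.inr ⟨hi, hj⟩
        · exact Or.inr ⟨hi, hk⟩ }

/-- Non-crossing half-pairings: non-crossing partitions whose blocks have at most two elements,
with at least one block of size 1 (a through string), which stay non-crossing when all the blocks
of size 1 are joined. -/
structure IsHalfPairing (π : Setoid (Fin n)) : Prop where
  nonCrossing : NonCrossing π
  card_le_two : ∀ i j k : Fin n, π i j → π i k → i = j ∨ i = k ∨ j = k
  exists_singleton : ∃ i, IsSingleton π i
  nonCrossing_join : NonCrossing (joinSingletons π)

/-- The cyclic interval `[r, s] = {r, r + 1, …, s}` modulo `n`. -/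
def cyclicIcc (r s : Fin n) : Set (Fin n) :=
  {x | if r ≤ s then r ≤ x ∧ x ≤ s else r ≤ x ∨ x ≤ s}

/-- The points strictly between `i` and `j` when one moves from `i` upwards to `j` modulo `n`, that
is, the cyclic interval `[i + 1, j - 1]`, which is empty if `j = i + 1` modulo `n`. -/
def cyclicIoo (i j : Fin n) : Set (Fin n) :=
  {x | if i < j then i < x ∧ x < j else i < x ∨ x < j}

/-- The point `i` has the out orientation: it is a singleton, or it belongs to a pair `(i, s)` such
that the cyclic interval `[i, s]` contains no singleton. -/
def IsOut (π : Setoid (Fin n)) (i : Fin n) : Prop :=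
  IsSingleton π i ∨ ∃ s, s ≠ i ∧ π i s ∧ ∀ x ∈ cyclicIcc i s, ¬ IsSingleton π x

/-- `i` covers `j`: both have the out orientation, and `π` pairs each point of the cyclic interval
`[i + 1, j - 1]` with another point of that interval (nothing is required if `j = i + 1`). -/
def Covers (π : Setoid (Fin n)) (i j : Fin n) : Prop :=
  IsOut π i ∧ IsOut π j ∧ ∀ x ∈ cyclicIoo i j, ∃ y ∈ cyclicIoo i j, y ≠ x ∧ π x y

open Classical in
/-- The letters of `w` at the singletons of `π`, from left to right. -/
noncomputable def throughWord {N : ℕ} (w : Word N n) (π : Setoid (Fin n)) : List (Letter N) :=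
  ((List.finRange n).filter fun i => IsSingleton π i).map w

/-- `π` is a `w`-pairing. -/
def IsWordPairing {N : ℕ} (w : Word N n) (π : Setoid (Fin n)) : Prop :=
  IsHalfPairing π ∧ (∀ r s, r ≠ s → π r s → w r = (w s).inv) ∧
    ReducesCyclically (List.ofFn w) (throughWord w π)

/-- `π` is `w`-admissible. -/
def IsAdmissible {N : ℕ} (w : Word N n) (π : Setoid (Fin n)) : Prop :=
  IsWordPairing w π ∧ ∀ i j, Covers π i j → w i ≠ (w j).inv

open Classical in
/-- The standard cyclic reduction of `w`: the letters of `w` at the through strings of the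
`w`-admissible half-pairing. A word that is reducible to 1 has no such half-pairing, and its cyclic
reduction is the empty word. -/
noncomputable def standardReduction {N : ℕ} (w : Word N n) : List (Letter N) :=
  if h : ∃ π : Setoid (Fin n), IsAdmissible w π then throughWord w h.choose else []

end Partitions

/-- The element of the group algebra `ℂ[F_N]` given by a string of letters. -/
noncomputable def wordElem {N : ℕ} (v : List (Letter N)) : MonoidAlgebra ℂ (FreeGroup (Fin N)) :=
  MonoidAlgebra.of ℂ (FreeGroup (Fin N)) (FreeGroup.mk v)

/-- `x = u_1 + u_1⁻¹ + ⋯ + u_N + u_N⁻¹`. -/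
noncomputable def x (N : ℕ) : MonoidAlgebra ℂ (FreeGroup (Fin N)) :=
  ∑ i : Fin N, (MonoidAlgebra.of ℂ (FreeGroup (Fin N)) (FreeGroup.of i) +
    MonoidAlgebra.of ℂ (FreeGroup (Fin N)) (FreeGroup.of i)⁻¹)

/-- The standard cyclic reduction applied to each word in the expansion
`x ^ n = ∑ w, w` over all words `w` of length `n`. -/
noncomputable def xPowHat (N n : ℕ) : MonoidAlgebra ℂ (FreeGroup (Fin N)) :=
  ∑ w : Word N n, wordElem (standardReduction w)

open Classical in
/-- The sum of all cyclically reduced words of length `k`. -/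
noncomputable def Q (N k : ℕ) : MonoidAlgebra ℂ (FreeGroup (Fin N)) :=
  ∑ w : Word N k with FreeGroup.IsCyclicallyReduced (List.ofFn w), wordElem (List.ofFn w)

open Classical in
/-- The coefficients `s_{n,k}`. For `k = 0` this is the number of words of length `n` that are
reducible to 1. -/
noncomputable def s (N n k : ℕ) : ℕ :=
  if k = 0 then (Finset.univ.filter fun w : Word N n => ReducibleToOne w).card
  else if k ≤ n ∧ Even (n - k) then (2 * N - 1) ^ ((n - k) / 2) * n.choose ((n - k) / 2)
  else 0

end FreeCycle

/-! Unroll the cycle. A half-pairing lifts to an `n`-periodic system of non-crossing arcs on the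
integers (`ArcSystem`), each pair becoming the arc that passes over no singleton. The out points are
exactly the points that are not right ends of arcs, and they determine all arcs, as closing brackets
determine a bracketing (`IsHalfPairing.eq_of_isOut_iff`). Conversely, if `2 * I.card < n`, the
periodic path that goes down at the points of `I` and up elsewhere gains height in each period, and
the arcs below it form a half-pairing whose non-out points are `I` (`exists_halfPairing`). Since
each pair has exactly one non-out point, half-pairings with `m` pairs correspond to `m`-subsets of
the points, for `2 * m < n`; this is the binomial coefficient.

Existence and uniqueness of the admissible half-pairing come from a walk in the Cayley tree. Repeat
the word periodically and start the walk at `-c * n`. If the word has a nontrivial value, the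
distance from the start eventually grows by a fixed `k > 0` whenever `c` grows by one
(`exists_translation_length`). After subtracting `k * c` it therefore stabilises to a height with
steps `±1` and gain `k` per period, a Busemann function (`exists_wordHeight`). The arcs below this
height are admissible: a down step cancels precisely the letter of the up step it is joined to.
Conversely, in any admissible system the walk is reduced along the visible out points, so the out
points must be the up steps (`out_iff_of_admissible`). The cyclic reduction condition follows from
the two letter conditions (`isAdmissible_iff_labels`).

For the coefficients, fix a half-pairing with `m` pairs and a cyclically reduced word at its
singletons. Starting at a singleton and moving right, every out point of a pair must only avoid the
inverse of the letter covering it, which leaves `2 * N - 1` choices, and every other paired point is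
forced (`exists_predecessor`, `card_admissible`). So each half-pairing contributes `(2 * N - 1) ^ m`
times `Q N (n - 2 * m)`, and summing over the subsets `I` gives `xPowHat_eq`. -/

namespace FreeCycle

/-! ### Reduced words, cancellation and translation length in the free group -/

section FreeGroupWords

variable {N : ℕ}

theorem Letter.inv_inv (l : Letter N) : l.inv.inv = l := by
  simp [Letter.inv]

theorem Letter.ne_inv_comm {l l' : Letter N} : l ≠ l'.inv ↔ l' ≠ l.inv := by
  constructor <;> rintro h rfl <;> exact h (Letter.inv_inv _).symm

/-- Mathlib's condition for two letters not to cancel. -/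
theorem Letter.ne_inv_iff {l l' : Letter N} : l ≠ l'.inv ↔ (l.1 = l'.1 → l.2 = l'.2) := by
  rcases l with ⟨a, b⟩
  rcases l' with ⟨a', b'⟩
  cases b <;> cases b' <;> simp [Letter.inv]

theorem invRev_singleton (l : Letter N) : FreeGroup.invRev [l] = [l.inv] := rfl

theorem mk_mul_mk_inv (l : Letter N) :
    (FreeGroup.mk [l] * FreeGroup.mk [l.inv] : FreeGroup (Fin N)) = 1 := by
  rw [← invRev_singleton, ← FreeGroup.inv_mk, mul_inv_cancel]

theorem isReduced_append_iff {X Y : List (Letter N)} :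
    FreeGroup.IsReduced (X ++ Y) ↔ FreeGroup.IsReduced X ∧ FreeGroup.IsReduced Y ∧
      ∀ a ∈ X.getLast?, ∀ b ∈ Y.head?, a ≠ b.inv := by
  simp only [Letter.ne_inv_iff]
  exact List.isChain_append

/-- Two reduced words cancel along a suffix of the first one. -/
theorem exists_cancellation {X Z : List (Letter N)} (hX : FreeGroup.IsReduced X)
    (hZ : FreeGroup.IsReduced Z) :
    ∃ X₁ Y Z₂, X = X₁ ++ Y ∧ Z = FreeGroup.invRev Y ++ Z₂ ∧ FreeGroup.IsReduced (X₁ ++ Z₂) := by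
  induction Z generalizing X with
  | nil => exact ⟨X, [], [], by simp, by simp, by simpa using hX⟩
  | cons z Z ih =>
    rcases List.eq_nil_or_concat X with rfl | ⟨X', a, rfl⟩
    · exact ⟨[], [], z :: Z, by simp, by simp, by simpa using hZ⟩
    · simp only [List.concat_eq_append] at *
      by_cases ha : a = z.inv
      · obtain ⟨X₁, Y, Z₂, rfl, rfl, hr⟩ := ih (X := X') (isReduced_append_iff.1 hX).1
          (hZ.infix ⟨[z], [], by simp⟩)
        refine ⟨X₁, Y ++ [a], Z₂, by simp, ?_, hr⟩
        subst ha
        rw [FreeGroup.invRev_append, invRev_singleton, Letter.inv_inv]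
        simp
      · refine ⟨X' ++ [a], [], z :: Z, by simp, by simp, ?_⟩
        refine isReduced_append_iff.2 ⟨hX, hZ, ?_⟩
        simpa using ha

theorem toWord_mk_of_isReduced {X : List (Letter N)} (h : FreeGroup.IsReduced X) :
    (FreeGroup.mk X).toWord = X := by
  rw [FreeGroup.toWord_mk, h.reduce_eq]

theorem mk_cancel (X Y Z : List (Letter N)) :
    FreeGroup.mk (X ++ Y) * FreeGroup.mk (FreeGroup.invRev Y ++ Z) = FreeGroup.mk (X ++ Z) := by
  simp only [← FreeGroup.mul_mk, ← FreeGroup.inv_mk]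
  group

theorem toWord_mul_letter_of_ne {g : FreeGroup (Fin N)} {l : Letter N}
    (h : g.toWord.getLast? ≠ some l.inv) :
    (g * FreeGroup.mk [l]).toWord = g.toWord ++ [l] := by
  conv_lhs => rw [← FreeGroup.mk_toWord (x := g), FreeGroup.mul_mk]
  refine toWord_mk_of_isReduced (isReduced_append_iff.2
    ⟨FreeGroup.isReduced_toWord, FreeGroup.IsReduced.singleton, ?_⟩)
  rintro a ha b hb rfl
  simp only [List.head?_cons, Option.mem_def, Option.some.injEq] at hb
  subst hb
  exact h ha

/-- Together with `norm_mul_letter_of_ne`: a step of the walk changes the distance to its start by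
one, and the last letter of the reduced word decides the direction. -/
theorem norm_mul_letter_of_eq {g : FreeGroup (Fin N)} {l : Letter N}
    (h : g.toWord.getLast? = some l.inv) :
    (g * FreeGroup.mk [l]).norm + 1 = g.norm := by
  obtain ⟨X, hX⟩ : ∃ X, g.toWord = X ++ [l.inv] := by
    rw [List.getLast?_eq_some_iff] at h
    exact h
  have h1 : g * FreeGroup.mk [l] = FreeGroup.mk X := by
    rw [← FreeGroup.mk_toWord (x := g), hX]
    have := mk_cancel X [l.inv] []
    rw [invRev_singleton, Letter.inv_inv] at this
    simpa using this
  have h2 : FreeGroup.IsReduced X :=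
    (FreeGroup.isReduced_toWord (x := g)).infix ⟨[], [l.inv], by simp [hX]⟩
  rw [h1, FreeGroup.norm, FreeGroup.norm, toWord_mk_of_isReduced h2, hX]
  simp

theorem norm_mul_letter_of_ne {g : FreeGroup (Fin N)} {l : Letter N}
    (h : g.toWord.getLast? ≠ some l.inv) : (g * FreeGroup.mk [l]).norm = g.norm + 1 := by
  rw [FreeGroup.norm, toWord_mul_letter_of_ne h]
  simp [FreeGroup.norm]

/-- Multiplication from the left by a short element does not change the last letter. -/
theorem getLast?_toWord_mul {g : FreeGroup (Fin N)} {T : List (Letter N)}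
    (hT : FreeGroup.IsReduced T) (h : g.norm < T.length) :
    (g * FreeGroup.mk T).toWord.getLast? = T.getLast? := by
  obtain ⟨X₁, Y, Z₂, h1, h2, h3⟩ := exists_cancellation (FreeGroup.isReduced_toWord (x := g)) hT
  have h4 : g * FreeGroup.mk T = FreeGroup.mk (X₁ ++ Z₂) := by
    rw [← mk_cancel X₁ Y Z₂, ← h1, ← h2, FreeGroup.mk_toWord]
  have h5 : Z₂ ≠ [] := by
    rintro rfl
    rw [h2, FreeGroup.norm, h1] at h
    simp at h
  rw [h4, toWord_mk_of_isReduced h3, h2, List.getLast?_append_of_ne_nil _ h5,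
    List.getLast?_append_of_ne_nil _ h5]

/-- The translation length of a nontrivial element of the free group. -/
theorem exists_translation_length {g : FreeGroup (Fin N)} (hg : g ≠ 1) :
    ∃ k : ℕ, 0 < k ∧ ∀ y : FreeGroup (Fin N), ∃ C : ℕ, ∀ c ≥ C,
      (g ^ (c + 1) * y).norm = (g ^ c * y).norm + k := by
  open FreeGroup.reduceCyclically in
  set A := conjugator g.toWord with hA
  set U := FreeGroup.reduceCyclically g.toWord with hU
  have hAU : A ++ U ++ FreeGroup.invRev A = g.toWord := conj_conjugator_reduceCyclically g.toWord
  have hUc : FreeGroup.IsCyclicallyReduced U := isCyclicallyReduced FreeGroup.isReduced_toWord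
  have hU0 : U ≠ [] := by
    intro h0
    apply hg
    rw [← FreeGroup.mk_toWord (x := g), ← hAU, h0]
    simp [← FreeGroup.mul_mk, ← FreeGroup.inv_mk]
  have hUlen : 0 < U.length := List.length_pos_iff.2 hU0
  have hAUr : FreeGroup.IsReduced (A ++ U) :=
    (FreeGroup.isReduced_toWord (x := g)).infix ⟨[], FreeGroup.invRev A, by simpa using hAU⟩
  have hg' : g = FreeGroup.mk A * FreeGroup.mk U * (FreeGroup.mk A)⁻¹ := by
    rw [FreeGroup.inv_mk, FreeGroup.mul_mk, FreeGroup.mul_mk, hAU, FreeGroup.mk_toWord]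
  have hpow : ∀ c, g ^ c = FreeGroup.mk A * FreeGroup.mk U ^ c * (FreeGroup.mk A)⁻¹ := by
    intro c
    rw [hg', conj_pow]
  refine ⟨U.length, hUlen, fun y => ?_⟩
  set z := (FreeGroup.mk A)⁻¹ * y with hz
  -- With `g = A U A⁻¹`, the power `U ^ c₀` is longer than `z`, so `z` cannot cancel it completely
  -- and `X₁` is nonempty.
  set c₀ := z.norm + 1 with hc₀
  obtain ⟨X₁, Y, Z₂, h1, h2, h3⟩ := exists_cancellation
    (hUc.flatten_replicate c₀).isReduced (FreeGroup.isReduced_toWord (x := z))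
  have hX₁ : X₁ ≠ [] := by
    rintro rfl
    have e1 := congrArg List.length h1
    have e2 := congrArg List.length h2
    simp only [List.length_flatten, List.map_replicate, List.sum_replicate, smul_eq_mul,
      List.length_append, List.nil_append, FreeGroup.invRev_length] at e1 e2
    have e3 : c₀ ≤ c₀ * U.length := Nat.le_mul_of_pos_right _ hUlen
    simp only [FreeGroup.norm] at hc₀
    omega
  -- Once `z` has been absorbed, each further factor `g` inserts one more copy of `U` into the
  -- reduced word. The exponent `e + 1` keeps at least one full copy, which serves as the overlap
  -- when reducedness is glued together.
  have key : ∀ e, (g ^ (c₀ + (e + 1)) * y).toWord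
      = A ++ (List.replicate (e + 1) U).flatten ++ X₁ ++ Z₂ := by
    intro e
    have e1 : g ^ (c₀ + (e + 1)) * y
        = FreeGroup.mk (A ++ (List.replicate (e + 1) U).flatten ++ X₁ ++ Z₂) := by
      have : g ^ (c₀ + (e + 1)) * y
          = FreeGroup.mk A * FreeGroup.mk U ^ (e + 1) * (FreeGroup.mk U ^ c₀ * z) := by
        rw [hpow, add_comm c₀, pow_add, hz]
        group
      rw [this, FreeGroup.pow_mk, FreeGroup.pow_mk, h1, ← FreeGroup.mk_toWord (x := z), h2,
        mk_cancel]
      simp [FreeGroup.mul_mk]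
    rw [e1]
    apply toWord_mk_of_isReduced
    have hfl : FreeGroup.IsReduced (A ++ (List.replicate (e + 1) U).flatten ++ []) :=
      FreeGroup.IsReduced.append_flatten_replicate_append hUc (by simpa using hAUr) (by simp)
    refine FreeGroup.IsReduced.append_overlap ?_ h3 hX₁
    rw [List.append_nil] at hfl
    refine FreeGroup.IsReduced.append_overlap hfl ?_ (by simp [hU0])
    have := (hUc.flatten_replicate (e + 1 + c₀)).isReduced
    rw [List.replicate_add, List.flatten_append, h1] at this
    exact this.infix ⟨[], Y, by simp⟩
  refine ⟨c₀ + 1, fun c hc => ?_⟩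
  obtain ⟨e, rfl⟩ := Nat.exists_eq_add_of_le hc
  have k1 := key e
  have k2 := key (e + 1)
  rw [show c₀ + 1 + e + 1 = c₀ + (e + 1 + 1) by ring, show c₀ + 1 + e = c₀ + (e + 1) by ring,
    FreeGroup.norm, FreeGroup.norm, k1, k2]
  simp
  ring

theorem reflTransGen_cyclicStep_of_red {v v' : List (Letter N)} (h : FreeGroup.Red v v') :
    Relation.ReflTransGen CyclicStep v v' :=
  Relation.ReflTransGen.mono (fun _ _ => CyclicStep.adjacent) _ _ h

/-- The head of `S` is the innermost conjugating letter: it is absorbed into `T`, the outer letters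
are removed by induction, and a last step removes it. -/
theorem reflTransGen_cyclicStep_conj (S T : List (Letter N)) :
    Relation.ReflTransGen CyclicStep (FreeGroup.invRev S ++ T ++ S) T := by
  induction S generalizing T with
  | nil => simpa using Relation.ReflTransGen.refl
  | cons a S ih =>
    have h1 : FreeGroup.invRev (a :: S) ++ T ++ a :: S
        = FreeGroup.invRev S ++ (a.inv :: (T ++ [a.inv.inv])) ++ S := by
      rw [FreeGroup.invRev_cons, invRev_singleton, Letter.inv_inv]
      simp
    rw [h1]
    exact (ih _).tail (CyclicStep.ends _ _)

/-- Cyclic reduction of a word with a reducible wrap-around part. -/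
theorem reflTransGen_cyclicStep_wrap {P M S T : List (Letter N)}
    (hM : FreeGroup.mk M = FreeGroup.mk T) (hT : FreeGroup.IsReduced T)
    (hSP : FreeGroup.mk (S ++ P) = 1) :
    Relation.ReflTransGen CyclicStep (P ++ M ++ S) T := by
  -- Since `S P` is trivial, the reduced forms of `P` and `S` are formally inverse, and the word
  -- becomes a conjugate of `T` letter by letter.
  have h1 : FreeGroup.reduce P = FreeGroup.invRev (FreeGroup.reduce S) := by
    rw [← FreeGroup.reduce_invRev]
    apply FreeGroup.reduce.sound
    rw [← FreeGroup.inv_mk, eq_inv_iff_mul_eq_one, mul_eq_one_iff_eq_inv, eq_comm,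
      inv_eq_iff_mul_eq_one, FreeGroup.mul_mk, hSP]
  have h2 : FreeGroup.Red M T := by
    rw [← hT.reduce_eq, ← FreeGroup.reduce.sound hM]
    exact FreeGroup.reduce.red
  have h3 : FreeGroup.Red (P ++ M ++ S)
      (FreeGroup.invRev (FreeGroup.reduce S) ++ T ++ FreeGroup.reduce S) := by
    rw [← h1]
    exact (FreeGroup.reduce.red.append_append h2).append_append FreeGroup.reduce.red
  exact (reflTransGen_cyclicStep_of_red h3).trans (reflTransGen_cyclicStep_conj _ _)

end FreeGroupWords

/-! ### Periodic non-crossing arcs on the integers -/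

/-- An `n`-periodic system of non-crossing arcs `i ⌢ s` on the integers such that all the points
below an arc are joined by arcs, and some point is not joined to any other. -/
structure ArcSystem (n : ℕ) (M : ℤ → ℤ → Prop) : Prop where
  lt : ∀ {i s}, M i s → i < s
  lt_add : ∀ {i s}, M i s → s < i + n
  shift : ∀ {i s}, M i s → M (i + n) (s + n)
  unshift : ∀ {i s}, M i s → M (i - n) (s - n)
  left_unique : ∀ {i s s'}, M i s → M i s' → s = s'
  right_unique : ∀ {i i' s}, M i s → M i' s → i = i'
  not_left : ∀ {i s t}, M i s → ¬ M s t
  interior : ∀ {i s t}, M i s → i < t → t < s → ∃ u, i < u ∧ u < s ∧ (M t u ∨ M u t)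
  exists_free : ∃ a, ∀ u, ¬ M a u ∧ ¬ M u a

/-- The point `a` is not joined to another point. -/
def Free (M : ℤ → ℤ → Prop) (a : ℤ) : Prop := ∀ u, ¬ M a u ∧ ¬ M u a

/-- The point `j` is not the right end of an arc. -/
def Out (M : ℤ → ℤ → Prop) (j : ℤ) : Prop := ∀ i, ¬ M i j

/-- All the points of `[a, b)` are joined within this interval. -/
def Balanced (M : ℤ → ℤ → Prop) (a b : ℤ) : Prop :=
  ∀ t, a ≤ t → t < b → ∃ u, a ≤ u ∧ u < b ∧ (M t u ∨ M u t)

section Arcs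

variable {n : ℕ} {M M' : ℤ → ℤ → Prop}

theorem Free.out {a : ℤ} (h : Free M a) : Out M a := fun i => (h i).2

theorem Balanced.not_free {a b t : ℤ} (h : Balanced M a b) (h1 : a ≤ t) (h2 : t < b) :
    ¬ Free M t := by
  intro hf
  obtain ⟨u, _, _, h | h⟩ := h t h1 h2
  · exact (hf u).1 h
  · exact (hf u).2 h

theorem balanced_self (a : ℤ) : Balanced M a a := fun t h1 h2 => by omega

theorem Balanced.append {a b c : ℤ} (h : Balanced M a b) (h' : Balanced M b c) (hab : a ≤ b)
    (hbc : b ≤ c) : Balanced M a c := by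
  intro t h1 h2
  rcases lt_or_ge t b with h3 | h3
  · obtain ⟨u, u1, u2, u3⟩ := h t h1 h3
    exact ⟨u, by omega, by omega, u3⟩
  · obtain ⟨u, u1, u2, u3⟩ := h' t h3 h2
    exact ⟨u, by omega, by omega, u3⟩

namespace ArcSystem

variable (hM : ArcSystem n M)

include hM

theorem balanced_interior {i s : ℤ} (h : M i s) : Balanced M (i + 1) s := by
  intro t h1 h2
  obtain ⟨u, u1, u2, u3⟩ := hM.interior h (by omega) h2
  exact ⟨u, by omega, by omega, u3⟩

theorem balanced_arc {i s : ℤ} (h : M i s) : Balanced M i (s + 1) := by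
  have his := hM.lt h
  intro t h1 h2
  rcases eq_or_lt_of_le h1 with rfl | h1
  · exact ⟨s, by omega, by omega, Or.inl h⟩
  rcases eq_or_lt_of_le (show t ≤ s by omega) with rfl | h2
  · exact ⟨i, by omega, by omega, Or.inr h⟩
  obtain ⟨u, u1, u2, u3⟩ := hM.interior h h1 h2
  exact ⟨u, by omega, by omega, u3⟩

/-- The first point of a nonempty balanced interval starts an arc, and the rest is balanced. -/
theorem balanced_cases {a b : ℤ} (h : Balanced M a b) (hab : a < b) :
    ∃ s, a < s ∧ s < b ∧ M a s ∧ Balanced M (a + 1) s ∧ Balanced M (s + 1) b := by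
  obtain ⟨s, s1, s2, hs | hs⟩ := h a le_rfl hab
  · have has := hM.lt hs
    refine ⟨s, has, s2, hs, hM.balanced_interior hs, ?_⟩
    intro t h1 h2
    obtain ⟨u, u1, u2, u3⟩ := h t (by omega) h2
    refine ⟨u, ?_, u2, u3⟩
    by_contra hu
    rcases eq_or_lt_of_le u1 with rfl | u1
    · rcases u3 with u3 | u3
      · have := hM.lt u3; omega
      · have := hM.left_unique hs u3; omega
    rcases eq_or_lt_of_le (show u ≤ s by omega) with rfl | u4
    · rcases u3 with u3 | u3
      · have := hM.right_unique hs u3; omega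
      · exact hM.not_left hs u3
    obtain ⟨x, x1, x2, x3⟩ := hM.interior hs u1 u4
    rcases u3 with u3 | u3 <;> rcases x3 with x3 | x3
    · exact hM.not_left u3 x3
    · have := hM.right_unique u3 x3; omega
    · have := hM.left_unique u3 x3; omega
    · exact hM.not_left x3 u3
  · have := hM.lt hs; omega

theorem free_shift {j : ℤ} (h : Free M j) : Free M (j + n) := by
  refine fun u => ⟨fun hu => ?_, fun hu => ?_⟩
  · have := hM.unshift hu
    rw [add_sub_cancel_right] at this
    exact (h _).1 this
  · have := hM.unshift hu
    rw [add_sub_cancel_right] at this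
    exact (h _).2 this

theorem free_unshift {j : ℤ} (h : Free M j) : Free M (j - n) := by
  refine fun u => ⟨fun hu => ?_, fun hu => ?_⟩
  · have := hM.shift hu
    rw [sub_add_cancel] at this
    exact (h _).1 this
  · have := hM.shift hu
    rw [sub_add_cancel] at this
    exact (h _).2 this

theorem free_shift_mul {j : ℤ} (h : Free M j) (c : ℕ) : Free M (j + c * n) := by
  induction c with
  | zero => simpa using h
  | succ c ih =>
    have := hM.free_shift ih
    rwa [show j + ((c + 1 : ℕ) : ℤ) * n = j + c * n + n by push_cast; ring]

theorem free_unshift_mul {j : ℤ} (h : Free M j) (c : ℕ) : Free M (j - c * n) := by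
  induction c with
  | zero => simpa using h
  | succ c ih =>
    have := hM.free_unshift ih
    rwa [show j - ((c + 1 : ℕ) : ℤ) * n = j - c * n - n by push_cast; ring]

theorem shift_mul {i s : ℤ} (h : M i s) (c : ℤ) : M (i + c * n) (s + c * n) := by
  induction c with
  | zero => simpa using h
  | succ c ih =>
    have := hM.shift ih
    rwa [add_mul, one_mul, ← add_assoc, ← add_assoc]
  | pred c ih =>
    have := hM.unshift ih
    rwa [sub_mul, one_mul, ← add_sub_assoc, ← add_sub_assoc]

theorem joined_unique {i j k : ℤ} (h : M i j ∨ M j i) (h' : M i k ∨ M k i) : j = k := by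
  rcases h with h | h <;> rcases h' with h' | h'
  · exact hM.left_unique h h'
  · exact absurd h (hM.not_left h')
  · exact absurd h' (hM.not_left h)
  · exact hM.right_unique h h'

/-- An arc does not pass over a free point. -/
theorem not_free_of_arc {i s t : ℤ} (h : M i s) (h1 : i ≤ t) (h2 : t ≤ s) : ¬ Free M t :=
  (hM.balanced_arc h).not_free h1 (by omega)

/-- Every point to the right of a free point `a` has an out point to its left (and not to the left
of `a`) from which it is separated by a balanced interval. -/
theorem exists_top {a j : ℤ} (ha : Free M a) (haj : a < j) :
    ∃ i, a ≤ i ∧ i < j ∧ Out M i ∧ Balanced M (i + 1) j := by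
  induction hd : (j - a).toNat using Nat.strong_induction_on generalizing j with
  | _ d ih =>
    by_cases ho : Out M (j - 1)
    · refine ⟨j - 1, by omega, by omega, ho, ?_⟩
      rw [sub_add_cancel]
      exact balanced_self j
    · obtain ⟨i₁, hi₁⟩ : ∃ i, M i (j - 1) := by simpa [Out] using ho
      have h1 := hM.lt hi₁
      have h2 : a < i₁ := by
        by_contra h
        exact hM.not_free_of_arc hi₁ (by omega) (by omega) ha
      obtain ⟨i, hi1, hi2, hi3, hi4⟩ := ih (i₁ - a).toNat (by omega) h2 rfl
      refine ⟨i, hi1, by omega, hi3, hi4.append ?_ (by omega) (by omega)⟩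
      have := hM.balanced_arc hi₁
      rwa [sub_add_cancel] at this

/-- If `i < i'`, then `i'` lies in the balanced interval after `i`, so, being out, it is joined to
some `s < j` on its right. But `s` lies in the balanced interval after `i'` and has its partner
there, a contradiction. -/
theorem top_unique {i i' j : ℤ} (hi : i < j) (hi' : i' < j) (ho : Out M i) (ho' : Out M i')
    (hb : Balanced M (i + 1) j) (hb' : Balanced M (i' + 1) j) : i = i' := by
  wlog h : i ≤ i' generalizing i i'
  · exact (this hi' hi ho' ho hb' hb (by omega)).symm
  by_contra hne
  obtain ⟨s, s1, s2, s3 | s3⟩ := hb i' (by omega) hi'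
  · have h1 := hM.lt s3
    obtain ⟨u, u1, u2, u3 | u3⟩ := hb' s (by omega) s2
    · exact hM.not_left s3 u3
    · have := hM.right_unique s3 u3; omega
  · exact ho' _ s3

/-- The arcs are determined by the set of the out points. -/
theorem arc_of_out_iff (hM' : ArcSystem n M') (h : ∀ j, Out M j ↔ Out M' j) {i s : ℤ}
    (his : M i s) : M' i s := by
  induction hd : (s - i).toNat using Nat.strong_induction_on generalizing i s with
  | _ d ih =>
    have h1 := hM.lt his
    have hs : ¬ Out M' s := by
      rw [← h]
      exact fun hs => hs _ his
    -- By induction the arcs below `i ⌢ s` also belong to `M'`. Hence `i` and `i'` are both out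
    -- points of `M'` visible from `s`, and they coincide.
    obtain ⟨i', hi'⟩ : ∃ i', M' i' s := by simpa [Out] using hs
    have hi'1 := hM'.lt hi'
    have hio : Out M' i := by
      rw [← h]
      exact fun j hj => hM.not_left hj his
    have hbal : Balanced M' (i + 1) s := by
      intro t t1 t2
      obtain ⟨u, u1, u2, u3 | u3⟩ := hM.interior his (t := t) (by omega) t2
      · have := hM.lt u3
        exact ⟨u, by omega, u2, Or.inl (ih _ (by omega) u3 rfl)⟩
      · have := hM.lt u3
        exact ⟨u, by omega, u2, Or.inr (ih _ (by omega) u3 rfl)⟩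
    have hi'o : Out M' i' := fun j hj => hM'.not_left hj hi'
    have := hM'.top_unique h1 hi'1 hio hi'o hbal (hM'.balanced_interior hi')
    rwa [this]

end ArcSystem

end Arcs

/-! ### Periodic labellings and products along intervals -/

section Words

variable {N n : ℕ} {M : ℤ → ℤ → Prop}

/-- The letters of `L` at the points `a, …, a + m - 1`. -/
def segment (L : ℤ → Letter N) (a : ℤ) (m : ℕ) : List (Letter N) :=
  (List.range m).map fun t : ℕ => L (a + t)

/-- The product of the letters of `L` at the points of `[a, b)`. -/
def segProd (L : ℤ → Letter N) (a b : ℤ) : FreeGroup (Fin N) :=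
  FreeGroup.mk (segment L a (b - a).toNat)

theorem segment_add (L : ℤ → Letter N) (a : ℤ) (m m' : ℕ) :
    segment L a (m + m') = segment L a m ++ segment L (a + m) m' := by
  simp [segment, List.range_add, add_assoc, Function.comp_def]

theorem segProd_self (L : ℤ → Letter N) (a : ℤ) : segProd L a a = 1 := by
  simp [segProd, segment, FreeGroup.one_eq_mk]

theorem segProd_succ_self (L : ℤ → Letter N) (a : ℤ) :
    segProd L a (a + 1) = FreeGroup.mk [L a] := by
  simp [segProd, segment]

theorem segProd_mul (L : ℤ → Letter N) {a b c : ℤ} (hab : a ≤ b) (hbc : b ≤ c) :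
    segProd L a b * segProd L b c = segProd L a c := by
  rw [segProd, segProd, segProd, FreeGroup.mul_mk,
    show (c - a).toNat = (b - a).toNat + (c - b).toNat by omega, segment_add,
    show a + ((b - a).toNat : ℤ) = b by omega]

/-- Bracket structure: split off the arc at the first point, whose inside and remainder are again
balanced. The letters are compared only on arcs within the interval, so that the lemma applies while
the pairing of longer arcs is still being proved. -/
theorem segProd_balanced (hM : ArcSystem n M) (L : ℤ → Letter N) {a b : ℤ} (hab : a ≤ b)
    (hL : ∀ i s, a ≤ i → s < b → M i s → L s = (L i).inv)
    (h : Balanced M a b) : segProd L a b = 1 := by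
  induction hd : (b - a).toNat using Nat.strong_induction_on generalizing a b with
  | _ d ih =>
    rcases eq_or_lt_of_le hab with rfl | hlt
    · exact segProd_self L a
    · obtain ⟨s, s1, s2, s3, s4, s5⟩ := hM.balanced_cases h hlt
      rw [← segProd_mul L (b := a + 1) (by omega) (by omega),
        ← segProd_mul L (a := a + 1) (b := s) (by omega) (by omega),
        ← segProd_mul L (a := s) (b := s + 1) (by omega) (by omega),
        ih _ (by omega) (by omega) (fun i u h1 h2 => hL i u (by omega) (by omega)) s4 rfl,
        ih _ (by omega) (by omega) (fun i u h1 h2 => hL i u (by omega) (by omega)) s5 rfl,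
        segProd_succ_self, segProd_succ_self, hL a s le_rfl s2 s3, one_mul, mul_one,
        mk_mul_mk_inv]

open Classical in
/-- The letters of `L` at the free points of `[a, a + m)`. -/
noncomputable def freeLetters (M : ℤ → ℤ → Prop) (L : ℤ → Letter N) (a : ℤ) (m : ℕ) :
    List (Letter N) :=
  (((List.range m).map fun t : ℕ => a + t).filter fun t => Free M t).map L

theorem freeLetters_add (L : ℤ → Letter N) (a : ℤ) (m m' : ℕ) :
    freeLetters M L a (m + m') = freeLetters M L a m ++ freeLetters M L (a + m) m' := by
  simp [freeLetters, List.range_add, add_assoc, Function.comp_def]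

theorem freeLetters_eq_nil (L : ℤ → Letter N) {a : ℤ} {m : ℕ}
    (h : ∀ t, a ≤ t → t < a + m → ¬ Free M t) : freeLetters M L a m = [] := by
  simp only [freeLetters, List.map_eq_nil_iff, List.filter_eq_nil_iff, List.mem_map,
    List.mem_range, decide_eq_true_eq]
  rintro _ ⟨t, ht, rfl⟩
  exact h _ (by omega) (by omega)

/-- If the arcs which meet an interval have both ends in it, then the word on this interval has the
same value as the word of the letters at the free points. -/
theorem mk_freeLetters (hM : ArcSystem n M) (L : ℤ → Letter N)
    (hL : ∀ i s, M i s → L s = (L i).inv) {a b : ℤ} (hab : a ≤ b)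
    (h : ∀ t, a ≤ t → t < b → Free M t ∨ ∃ u, a ≤ u ∧ u < b ∧ (M t u ∨ M u t)) :
    FreeGroup.mk (freeLetters M L a (b - a).toNat) = segProd L a b := by
  induction hd : (b - a).toNat using Nat.strong_induction_on generalizing a with
  | _ d ih =>
    rcases eq_or_lt_of_le hab with rfl | hlt
    · rw [segProd_self, ← hd]
      simp [freeLetters, FreeGroup.one_eq_mk]
    · rcases h a le_rfl hlt with hf | ⟨s, s1, s2, s3⟩
      · have h1 := ih (b - (a + 1)).toNat (by omega) (a := a + 1) (by omega) (by
          intro t t1 t2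
          rcases h t (by omega) t2 with h3 | ⟨u, u1, u2, u3⟩
          · exact Or.inl h3
          · refine Or.inr ⟨u, ?_, u2, u3⟩
            by_contra hu
            obtain rfl : u = a := by omega
            rcases u3 with u3 | u3
            · exact (hf _).2 u3
            · exact (hf _).1 u3) rfl
        rw [← segProd_mul L (b := a + 1) (by omega) (by omega), segProd_succ_self, ← h1,
          show d = 1 + (b - (a + 1)).toNat by omega, freeLetters_add, ← FreeGroup.mul_mk]
        congr 1
        simp [freeLetters, hf]
      · have s4 : M a s := by
          rcases s3 with s3 | s3
          · exact s3
          · have := hM.lt s3; omega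
        have s5 := hM.lt s4
        have hb := hM.balanced_arc s4
        have h1 := ih (b - (s + 1)).toNat (by omega) (a := s + 1) (by omega) (by
          intro t t1 t2
          rcases h t (by omega) t2 with h3 | ⟨u, u1, u2, u3⟩
          · exact Or.inl h3
          · refine Or.inr ⟨u, ?_, u2, u3⟩
            by_contra hu
            obtain ⟨x, x1, x2, x3⟩ := hb u u1 (by omega)
            rcases u3 with u3 | u3 <;> rcases x3 with x3 | x3
            · exact hM.not_left u3 x3
            · have := hM.right_unique u3 x3; omega
            · have := hM.left_unique u3 x3; omega
            · exact hM.not_left x3 u3) rfl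
        rw [← segProd_mul L (b := s + 1) (by omega) (by omega), ← h1,
          segProd_balanced hM L (by omega) (fun i u _ _ => hL i u) hb, one_mul,
          show d = (s + 1 - a).toNat + (b - (s + 1)).toNat by omega, freeLetters_add,
          freeLetters_eq_nil L, List.nil_append]
        · congr 2; omega
        · intro t t1 t2
          exact hb.not_free t1 (by omega)

/-- Number of the free points of `[a, b)`. -/
noncomputable def freeCount (M : ℤ → ℤ → Prop) (a b : ℤ) : ℕ :=
  {t ∈ Set.Ico a b | Free M t}.ncard

/-- A balanced interval contains no free point, so only `i` can be new. This bounds the number of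
free points by the length of the reduced word built along visible out points. -/
theorem freeCount_le_succ {a i j : ℤ} (h : Balanced M (i + 1) j) :
    freeCount M a j ≤ freeCount M a i + 1 := by
  have h1 : {t ∈ Set.Ico a j | Free M t} ⊆ insert i {t ∈ Set.Ico a i | Free M t} := by
    rintro t ⟨⟨h1, h2⟩, h3⟩
    rcases lt_trichotomy t i with h4 | h4 | h4
    · exact Or.inr ⟨⟨h1, h4⟩, h3⟩
    · exact Or.inl h4
    · exact absurd h3 (h.not_free (by omega) h2)
  have hfin : {t ∈ Set.Ico a i | Free M t}.Finite := (Set.finite_Ico a i).subset (Set.sep_subset _ _)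
  exact (Set.ncard_le_ncard h1 (hfin.insert i)).trans (Set.ncard_insert_le _ _)

/-- The translates of `a` by multiples of `n` are free. -/
theorem le_freeCount (hM : ArcSystem n M) {a j : ℤ} (ha : Free M a) (hn : 0 < n) (c : ℕ)
    (hj : a + c * n ≤ j) : c ≤ freeCount M a j := by
  have h1 : (fun t : ℕ => a + t * n) '' (Set.Iio c) ⊆ {t ∈ Set.Ico a j | Free M t} := by
    rintro _ ⟨t, ht, rfl⟩
    refine ⟨⟨?_, ?_⟩, hM.free_shift_mul ha t⟩
    · show a ≤ a + t * n
      have : 0 ≤ (t : ℤ) * n := by positivity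
      omega
    · show a + t * n < j
      have : (t : ℤ) * n < c * n := by
        have : t < c := ht
        gcongr
      omega
  have hfin : {t ∈ Set.Ico a j | Free M t}.Finite := (Set.finite_Ico a j).subset (Set.sep_subset _ _)
  have h2 := Set.ncard_le_ncard h1 hfin
  rw [Set.ncard_image_of_injective] at h2
  · simpa [freeCount, Set.ncard_eq_toFinset_card'] using h2
  · intro t t' h
    have h' : a + t * n = a + t' * n := h
    have : (t : ℤ) * n = t' * n := by omega
    have hn' : (n : ℤ) ≠ 0 := by omega
    exact_mod_cast mul_right_cancel₀ hn' this

/-- For an admissible labelling, the product from a free point `a` to `j` has a reduced word which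
ends with the letter at the out point which is visible from `j`. -/
theorem exists_reduced_segProd (hM : ArcSystem n M) (L : ℤ → Letter N)
    (hL : ∀ i s, M i s → L s = (L i).inv)
    (hC : ∀ i j, i < j → Out M i → Out M j → Balanced M (i + 1) j → L i ≠ (L j).inv)
    {a j : ℤ} (ha : Free M a) (haj : a < j) :
    ∃ T, FreeGroup.IsReduced T ∧ FreeGroup.mk T = segProd L a j ∧ freeCount M a j ≤ T.length ∧
      ∀ i, i < j → Out M i → Balanced M (i + 1) j → T.getLast? = some (L i) := by
  induction hd : (j - a).toNat using Nat.strong_induction_on generalizing j with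
  | _ d ih =>
    -- What lies between the visible out point `i` and `j` has trivial product, so the word up to
    -- `j` is the word up to `i` followed by `L i`; the covering condition prevents cancellation.
    obtain ⟨i, i1, i2, i3, i4⟩ := hM.exists_top ha haj
    have hprod : segProd L a j = segProd L a i * FreeGroup.mk [L i] := by
      rw [← segProd_mul L (b := i) (by omega) (by omega),
        ← segProd_mul L (a := i) (b := i + 1) (by omega) (by omega), segProd_succ_self,
        segProd_balanced hM L (by omega) (fun i s _ _ => hL i s) i4, mul_one]
    have huniq : ∀ i', i' < j → Out M i' → Balanced M (i' + 1) j → i' = i := fun i' h1 h2 h3 =>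
      hM.top_unique h1 i2 h2 i3 h3 i4
    rcases eq_or_lt_of_le i1 with rfl | i1
    · refine ⟨[L a], FreeGroup.IsReduced.singleton, ?_, ?_, ?_⟩
      · rw [hprod, segProd_self, one_mul]
      · refine (freeCount_le_succ i4).trans ?_
        simp [freeCount]
      · intro i' h1 h2 h3
        rw [huniq i' h1 h2 h3]
        rfl
    · obtain ⟨T, T1, T2, T3, T4⟩ := ih _ (by omega) i1 rfl
      refine ⟨T ++ [L i], ?_, ?_, ?_, ?_⟩
      · refine isReduced_append_iff.2 ⟨T1, FreeGroup.IsReduced.singleton, ?_⟩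
        intro x hx y hy
        obtain ⟨i', i'1, i'2, i'3, i'4⟩ := hM.exists_top ha i1
        rw [T4 i' i'2 i'3 i'4] at hx
        simp only [Option.mem_def, Option.some.injEq, List.head?_cons] at hx hy
        subst hx hy
        exact hC _ _ i'2 i'3 i3 i'4
      · rw [← FreeGroup.mul_mk, T2, hprod]
      · have := freeCount_le_succ (a := a) i4
        simp
        omega
      · intro i' h1 h2 h3
        rw [huniq i' h1 h2 h3]
        simp

end Words

/-! ### Passage between half-pairings of `Fin n` and periodic arcs -/

section Lift

variable {n : ℕ} [NeZero n]

/-- The residue class of an integer, as a point of `Fin n`. -/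
def pt (n : ℕ) [NeZero n] (i : ℤ) : Fin n :=
  ⟨(i % n).toNat, by
    have h : (0 : ℤ) < n := by exact_mod_cast Nat.pos_of_neZero n
    have := Int.emod_lt_of_pos i h
    have := Int.emod_nonneg i h.ne'
    omega⟩

theorem coe_pt (i : ℤ) : ((pt n i : ℕ) : ℤ) = i % n := by
  have h : (0 : ℤ) < n := by exact_mod_cast Nat.pos_of_neZero n
  exact Int.toNat_of_nonneg (Int.emod_nonneg i h.ne')

theorem pt_eq_iff {i j : ℤ} : pt n i = pt n j ↔ i % n = j % n := by
  rw [← coe_pt, ← coe_pt, Fin.ext_iff]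
  omega

theorem coe_pt_of_lt {i : ℤ} (h0 : 0 ≤ i) (h1 : i < n) : ((pt n i : ℕ) : ℤ) = i := by
  rw [coe_pt, Int.emod_eq_of_lt h0 h1]

theorem pt_add_mul (i c : ℤ) : pt n (i + c * n) = pt n i := by
  rw [pt_eq_iff, Int.add_mul_emod_self_right]

theorem pt_add (i : ℤ) : pt n (i + n) = pt n i := by
  simpa using pt_add_mul i 1

theorem pt_sub (i : ℤ) : pt n (i - n) = pt n i := by
  have := pt_add (n := n) (i - n)
  rw [sub_add_cancel] at this
  exact this.symm

theorem pt_coe (x : Fin n) : pt n ((x : ℕ) : ℤ) = x := by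
  have h := coe_pt_of_lt (n := n) (i := ((x : ℕ) : ℤ)) (by omega) (by omega)
  exact Fin.ext (by exact_mod_cast h)

theorem eq_of_pt_eq {i j : ℤ} (h : pt n i = pt n j) (h1 : i < j + n) (h2 : j < i + n) : i = j := by
  rw [pt_eq_iff] at h
  obtain ⟨c, hc⟩ := (Int.emod_eq_emod_iff_emod_sub_eq_zero.1 h |> Int.dvd_of_emod_eq_zero)
  rcases lt_trichotomy c 0 with h3 | h3 | h3
  · nlinarith
  · subst h3; omega
  · nlinarith

theorem exists_eq_add_mul {i j : ℤ} (h : pt n i = pt n j) : ∃ c : ℤ, i = j + c * n := by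
  rw [pt_eq_iff] at h
  obtain ⟨c, hc⟩ := (Int.emod_eq_emod_iff_emod_sub_eq_zero.1 h |> Int.dvd_of_emod_eq_zero)
  exact ⟨c, by linarith⟩

theorem exists_lift (i : ℤ) (x : Fin n) : ∃ t, i ≤ t ∧ t < i + n ∧ pt n t = x := by
  have h : (0 : ℤ) < n := by exact_mod_cast Nat.pos_of_neZero n
  refine ⟨i + ((x : ℕ) - i) % n, ?_, ?_, ?_⟩
  · have := Int.emod_nonneg ((x : ℕ) - i) h.ne'
    omega
  · have := Int.emod_lt_of_pos ((x : ℕ) - i) h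
    omega
  · conv_rhs => rw [← pt_coe x]
    rw [pt_eq_iff]
    simp

theorem exists_lift_of_ne {i : ℤ} {x : Fin n} (h : x ≠ pt n i) :
    ∃ t, i < t ∧ t < i + n ∧ pt n t = x := by
  obtain ⟨t, t1, t2, t3⟩ := exists_lift i x
  refine ⟨t, lt_of_le_of_ne t1 ?_, t2, t3⟩
  rintro rfl
  exact h t3.symm

theorem pt_ne_of_lt {i j : ℤ} (h1 : i < j) (h2 : j < i + n) : pt n i ≠ pt n j := fun h => by
  have := eq_of_pt_eq h (by omega) h2
  omega

/-- Translates by multiples of `n` to the fundamental domain. -/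
theorem exists_translate (i : ℤ) : ∃ c : ℤ, 0 ≤ i + c * n ∧ i + c * n < n := by
  have h : (0 : ℤ) < n := by exact_mod_cast Nat.pos_of_neZero n
  refine ⟨-(i / n), ?_⟩
  have h1 := Int.emod_nonneg i h.ne'
  have h2 := Int.emod_lt_of_pos i h
  have h3 := Int.emod_add_mul_ediv i n
  constructor <;> nlinarith

theorem coe_pt_of_ge {i : ℤ} (h0 : (n : ℤ) ≤ i) (h1 : i < 2 * n) :
    ((pt n i : ℕ) : ℤ) = i - n := by
  rw [← pt_sub, coe_pt_of_lt (by omega) (by omega)]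

theorem coe_pt_cases {i : ℤ} (h0 : 0 ≤ i) (h1 : i < 2 * n) :
    (i < n ∧ ((pt n i : ℕ) : ℤ) = i) ∨ ((n : ℤ) ≤ i ∧ ((pt n i : ℕ) : ℤ) = i - n) := by
  rcases lt_or_ge i n with h | h
  · exact Or.inl ⟨h, coe_pt_of_lt h0 h⟩
  · exact Or.inr ⟨h, coe_pt_of_ge h h1⟩

/-- Non-crossing depends only on the cyclic order: move `i` into `[0, n)` and distinguish which of
the other points have wrapped around. -/
theorem NonCrossing.lift {π : Setoid (Fin n)} (hπ : NonCrossing π) {i t s u : ℤ} (h1 : i < t)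
    (h2 : t < s) (h3 : s < u) (h4 : u < i + n) (his : π (pt n i) (pt n s))
    (htu : π (pt n t) (pt n u)) : π (pt n i) (pt n t) := by
  obtain ⟨c, c1, c2⟩ := exists_translate (n := n) i
  rw [← pt_add_mul i c] at *
  rw [← pt_add_mul s c] at his
  rw [← pt_add_mul t c] at *
  rw [← pt_add_mul u c] at htu
  have pi := coe_pt_of_lt c1 c2
  have pt' := coe_pt_cases (n := n) (i := t + c * n) (by omega) (by omega)
  have ps := coe_pt_cases (n := n) (i := s + c * n) (by omega) (by omega)
  have pu := coe_pt_cases (n := n) (i := u + c * n) (by omega) (by omega)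
  generalize pt n (i + c * n) = I at *
  generalize pt n (t + c * n) = T at *
  generalize pt n (s + c * n) = S at *
  generalize pt n (u + c * n) = U at *
  rcases pt' with ⟨t1, t2⟩ | ⟨t1, t2⟩
  · rcases ps with ⟨s1, s2⟩ | ⟨s1, s2⟩
    · rcases pu with ⟨u1, u2⟩ | ⟨u1, u2⟩
      · exact hπ I T S U (by omega) (by omega) (by omega) his htu
      · have := hπ U I T S (by omega) (by omega) (by omega) (π.symm' htu) his
        exact π.symm' (π.trans' htu this)
    · have := hπ S U I T (by omega) (by omega) (by omega) (π.symm' his) (π.symm' htu)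
      exact π.trans' his (π.trans' this (π.symm' htu))
  · have := hπ T S U I (by omega) (by omega) (by omega) htu (π.symm' his)
    exact π.trans' his (π.symm' this)

theorem mem_cyclicIcc_iff {i s : ℤ} (h1 : i ≤ s) (h2 : s < i + n) {x : Fin n} :
    x ∈ cyclicIcc (pt n i) (pt n s) ↔ ∃ t, i ≤ t ∧ t ≤ s ∧ pt n t = x := by
  obtain ⟨c, c1, c2⟩ := exists_translate (n := n) i
  obtain ⟨t, t1, t2, rfl⟩ := exists_lift i x
  have key : (∃ t', i ≤ t' ∧ t' ≤ s ∧ pt n t' = pt n t) ↔ t ≤ s := by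
    constructor
    · rintro ⟨t', t'1, t'2, h⟩
      have := eq_of_pt_eq h (by omega) (by omega)
      omega
    · exact fun h => ⟨t, t1, h, rfl⟩
  rw [key]
  have pi := coe_pt_of_lt c1 c2
  have pt' := coe_pt_cases (n := n) (i := t + c * n) (by omega) (by omega)
  have ps := coe_pt_cases (n := n) (i := s + c * n) (by omega) (by omega)
  rw [pt_add_mul] at pi pt' ps
  generalize pt n i = I at *
  generalize pt n t = T at *
  generalize pt n s = S at *
  simp only [cyclicIcc, Set.mem_ofPred_eq, Fin.le_def]
  split_ifs <;> omega

/-- The case `j = i + n` is included: a single out point may cover itself after a full turn, and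
`cyclicIoo` of equal ends is then everything except that point. -/
theorem mem_cyclicIoo_iff {i j : ℤ} (h1 : i < j) (h2 : j ≤ i + n) {x : Fin n} :
    x ∈ cyclicIoo (pt n i) (pt n j) ↔ ∃ t, i < t ∧ t < j ∧ pt n t = x := by
  obtain ⟨c, c1, c2⟩ := exists_translate (n := n) i
  obtain ⟨t, t1, t2, rfl⟩ := exists_lift i x
  have key : (∃ t', i < t' ∧ t' < j ∧ pt n t' = pt n t) ↔ i < t ∧ t < j := by
    constructor
    · rintro ⟨t', t'1, t'2, h⟩
      have := eq_of_pt_eq h (by omega) (by omega)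
      omega
    · exact fun h => ⟨t, h.1, h.2, rfl⟩
  rw [key]
  have pi := coe_pt_of_lt c1 c2
  have pt' := coe_pt_cases (n := n) (i := t + c * n) (by omega) (by omega)
  have pj := coe_pt_cases (n := n) (i := j + c * n) (by omega) (by omega)
  rw [pt_add_mul] at pi pt' pj
  generalize pt n i = I at *
  generalize pt n t = T at *
  generalize pt n j = J at *
  simp only [cyclicIoo, Set.mem_ofPred_eq, Fin.lt_def]
  split_ifs <;> omega

/-- The arcs of a half-pairing: its pairs `(i, s)`, lifted to the integers, such that no singleton
lies between `i` and `s`. -/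
def arcs (π : Setoid (Fin n)) (i s : ℤ) : Prop :=
  i < s ∧ s < i + n ∧ π (pt n i) (pt n s) ∧ ∀ t, i ≤ t → t ≤ s → ¬ IsSingleton π (pt n t)

namespace IsHalfPairing

variable {π : Setoid (Fin n)} (hπ : IsHalfPairing π)

include hπ

/-- If both sides of a pair contained singletons, the block of joined singletons would cross the
pair. -/
theorem arcs_or_arcs {i s : ℤ} (h1 : i < s) (h2 : s < i + n) (h : π (pt n i) (pt n s)) :
    arcs π i s ∨ arcs π s (i + n) := by
  by_contra hcon
  push Not at hcon
  obtain ⟨hc1, hc2⟩ := hcon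
  have hne := pt_ne_of_lt (n := n) h1 h2
  have e1 : ∃ t, i < t ∧ t < s ∧ IsSingleton π (pt n t) := by
    by_contra hcon
    push Not at hcon
    refine hc1 ⟨h1, h2, h, fun t t1 t2 ht => ?_⟩
    rcases eq_or_lt_of_le t1 with rfl | t1
    · exact hne (ht _ h).symm
    rcases eq_or_lt_of_le t2 with rfl | t2
    · exact hne (ht _ (π.symm' h))
    exact hcon t t1 t2 ht
  have e2 : ∃ t, s < t ∧ t < i + n ∧ IsSingleton π (pt n t) := by
    by_contra hcon
    push Not at hcon
    refine hc2 ⟨h2, by omega, by rw [pt_add]; exact π.symm' h, fun t t1 t2 ht => ?_⟩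
    rcases eq_or_lt_of_le t1 with rfl | t1
    · exact hne (ht _ (π.symm' h))
    rcases eq_or_lt_of_le t2 with rfl | t2
    · rw [pt_add] at ht
      exact hne (ht _ h).symm
    exact hcon t t1 t2 ht
  obtain ⟨t, t1, t2, t3⟩ := e1
  obtain ⟨u, u1, u2, u3⟩ := e2
  rcases hπ.nonCrossing_join.lift t1 t2 u1 u2 (Or.inl h) (Or.inr ⟨t3, u3⟩) with h5 | h5
  · exact pt_ne_of_lt (n := n) t1 (by omega) (t3 _ (π.symm' h5))
  · exact hne (h5.1 _ h).symm

theorem arcs_iff {i s : ℤ} (h1 : i < s) (h2 : s < i + n) :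
    π (pt n i) (pt n s) ↔ arcs π i s ∨ arcs π s (i + n) := by
  refine ⟨hπ.arcs_or_arcs h1 h2, ?_⟩
  rintro (h | h)
  · exact h.2.2.1
  · have := h.2.2.1
    rw [pt_add] at this
    exact π.symm' this

theorem arcSystem : ArcSystem n (arcs π) where
  lt h := h.1
  lt_add h := h.2.1
  shift := by
    rintro i s ⟨h1, h2, h3, h4⟩
    refine ⟨by omega, by omega, by rwa [pt_add, pt_add], fun t t1 t2 => ?_⟩
    have := h4 (t - n) (by omega) (by omega)
    rwa [pt_sub] at this
  unshift := by
    rintro i s ⟨h1, h2, h3, h4⟩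
    refine ⟨by omega, by omega, by rwa [pt_sub, pt_sub], fun t t1 t2 => ?_⟩
    have := h4 (t + n) (by omega) (by omega)
    rwa [pt_add] at this
  left_unique := by
    rintro i s s' ⟨h1, h2, h3, h4⟩ ⟨h1', h2', h3', h4'⟩
    rcases hπ.card_le_two _ _ _ h3 h3' with h | h | h
    · exact absurd h (pt_ne_of_lt h1 h2)
    · exact absurd h (pt_ne_of_lt h1' h2')
    · exact eq_of_pt_eq h (by omega) (by omega)
  right_unique := by
    rintro i i' s ⟨h1, h2, h3, h4⟩ ⟨h1', h2', h3', h4'⟩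
    rcases hπ.card_le_two _ _ _ (π.symm' h3) (π.symm' h3') with h | h | h
    · exact absurd h.symm (pt_ne_of_lt h1 h2)
    · exact absurd h.symm (pt_ne_of_lt h1' h2')
    · exact eq_of_pt_eq h (by omega) (by omega)
  not_left := by
    rintro i s t ⟨h1, h2, h3, h4⟩ ⟨h1', h2', h3', h4'⟩
    have hit : pt n i = pt n t := by
      rcases hπ.card_le_two _ _ _ (π.symm' h3) h3' with h | h | h
      · exact absurd h.symm (pt_ne_of_lt h1 h2)
      · exact absurd h (pt_ne_of_lt h1' h2')
      · exact h
    -- A point which is both a right and a left end would give two arcs that together pass over a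
    -- whole period, including a singleton.
    have ht : t = i + n := by
      refine eq_of_pt_eq (n := n) ?_ (by omega) (by omega)
      rw [pt_add, hit]
    obtain ⟨x, hx⟩ := hπ.exists_singleton
    obtain ⟨y, y1, y2, rfl⟩ := exists_lift i x
    rcases le_or_gt y s with h | h
    · exact h4 y y1 h hx
    · exact h4' y h.le (by omega) hx
  interior := by
    rintro i s t ⟨h1, h2, h3, h4⟩ it ts
    have hns := h4 t it.le ts.le
    obtain ⟨y, hy, hne⟩ : ∃ y, π (pt n t) y ∧ y ≠ pt n t := by
      simpa [IsSingleton] using hns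
    obtain ⟨u, u1, u2, rfl⟩ := exists_lift i y
    have hui : u ≠ i := by
      rintro rfl
      rcases hπ.card_le_two _ _ _ h3 (π.symm' hy) with h | h | h
      · exact pt_ne_of_lt h1 h2 h
      · exact hne h
      · exact pt_ne_of_lt ts (by omega) h.symm
    have hus : u ≠ s := by
      rintro rfl
      rcases hπ.card_le_two _ _ _ (π.symm' h3) (π.symm' hy) with h | h | h
      · exact pt_ne_of_lt h1 h2 h.symm
      · exact hne h
      · exact pt_ne_of_lt it (by omega) h
    have hus' : u < s := by
      by_contra hcon
      have h5 := hπ.nonCrossing.lift it ts (u := u) (by omega) u2 h3 hy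
      rcases hπ.card_le_two _ _ _ h3 h5 with h | h | h
      · exact pt_ne_of_lt h1 h2 h
      · exact pt_ne_of_lt it (by omega) h
      · exact pt_ne_of_lt ts (by omega) h.symm
    have hut : u ≠ t := by
      rintro rfl
      exact hne rfl
    refine ⟨u, by omega, hus', ?_⟩
    rcases lt_or_gt_of_ne hut with h | h
    · exact Or.inr ⟨h, by omega, π.symm' hy, fun x x1 x2 => h4 x (by omega) (by omega)⟩
    · exact Or.inl ⟨h, by omega, hy, fun x x1 x2 => h4 x (by omega) (by omega)⟩
  exists_free := by
    obtain ⟨x, hx⟩ := hπ.exists_singleton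
    refine ⟨((x : ℕ) : ℤ), fun u => ⟨fun h => ?_, fun h => ?_⟩⟩
    · exact h.2.2.2 _ le_rfl h.1.le (by rwa [pt_coe])
    · exact h.2.2.2 _ h.1.le le_rfl (by rwa [pt_coe])

theorem free_iff {a : ℤ} : Free (arcs π) a ↔ IsSingleton π (pt n a) := by
  constructor
  · intro h
    by_contra hns
    obtain ⟨y, hy, hne⟩ : ∃ y, π (pt n a) y ∧ y ≠ pt n a := by
      simpa [IsSingleton] using hns
    obtain ⟨s, s1, s2, rfl⟩ := exists_lift_of_ne hne
    rcases hπ.arcs_or_arcs s1 s2 hy with h1 | h1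
    · exact (h _).1 h1
    · have := hπ.arcSystem.unshift h1
      rw [add_sub_cancel_right] at this
      exact (h _).2 this
  · exact fun hx u => ⟨fun h => h.2.2.2 _ le_rfl h.1.le hx, fun h => h.2.2.2 _ h.1.le le_rfl hx⟩

theorem out_iff {j : ℤ} : Out (arcs π) j ↔ IsOut π (pt n j) := by
  constructor
  · intro h
    by_cases hns : IsSingleton π (pt n j)
    · exact Or.inl hns
    obtain ⟨y, hy, hne⟩ : ∃ y, π (pt n j) y ∧ y ≠ pt n j := by
      simpa [IsSingleton] using hns
    obtain ⟨s, s1, s2, rfl⟩ := exists_lift_of_ne hne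
    rcases hπ.arcs_or_arcs s1 s2 hy with h1 | h1
    · refine Or.inr ⟨pt n s, hne, hy, fun x hx => ?_⟩
      obtain ⟨t, t1, t2, rfl⟩ := (mem_cyclicIcc_iff s1.le s2).1 hx
      exact h1.2.2.2 t t1 t2
    · have := hπ.arcSystem.unshift h1
      rw [add_sub_cancel_right] at this
      exact absurd this (h _)
  · rintro (h | ⟨y, hne, hy, h⟩)
    · exact (hπ.free_iff.2 h).out
    · obtain ⟨s, s1, s2, rfl⟩ := exists_lift_of_ne hne
      have : arcs π j s := ⟨s1, s2, hy, fun t t1 t2 =>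
        h _ ((mem_cyclicIcc_iff s1.le s2).2 ⟨t, t1, t2, rfl⟩)⟩
      exact fun i hi => hπ.arcSystem.not_left hi this

theorem covers_iff {i j : ℤ} (h1 : i < j) (h2 : j ≤ i + n) : Covers π (pt n i) (pt n j) ↔
    Out (arcs π) i ∧ Out (arcs π) j ∧ Balanced (arcs π) (i + 1) j := by
  rw [Covers, hπ.out_iff, hπ.out_iff]
  refine and_congr_right fun _ => and_congr_right fun _ => ?_
  constructor
  · intro h
    have hns : ∀ t, i < t → t < j → ¬ IsSingleton π (pt n t) := by
      intro t t1 t2 hs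
      obtain ⟨y, -, hy1, hy2⟩ := h (pt n t) ((mem_cyclicIoo_iff h1 h2).2 ⟨t, t1, t2, rfl⟩)
      exact hy1 (hs y hy2)
    -- Cyclic partners inside the interval might be joined around the outside. Such an arc and the
    -- singleton-free stretch from `x` to `y` would leave no room for a singleton.
    have hwrap : ∀ x y, i < x → x < y → y < j → ¬ arcs π y (x + n) := by
      intro x y x1 xy y1 hxy
      obtain ⟨z, hz⟩ := hπ.exists_singleton
      obtain ⟨t, t1, t2, rfl⟩ := exists_lift x z
      rcases le_or_gt y t with h3 | h3
      · exact hxy.2.2.2 t h3 (by omega) hz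
      · exact hns t (by omega) (by omega) hz
    intro t t1 t2
    obtain ⟨y, hy, hy1, hy2⟩ := h (pt n t) ((mem_cyclicIoo_iff h1 h2).2 ⟨t, by omega, t2, rfl⟩)
    obtain ⟨u, u1, u2, rfl⟩ := (mem_cyclicIoo_iff h1 h2).1 hy
    refine ⟨u, by omega, u2, ?_⟩
    have hut : u ≠ t := by
      rintro rfl
      exact hy1 rfl
    rcases lt_or_gt_of_ne hut with h3 | h3
    · rcases hπ.arcs_or_arcs h3 (by omega) (π.symm' hy2) with h4 | h4
      · exact Or.inr h4
      · exact absurd h4 (hwrap u t u1 h3 t2)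
    · rcases hπ.arcs_or_arcs h3 (by omega) hy2 with h4 | h4
      · exact Or.inl h4
      · exact absurd h4 (hwrap t u (by omega) h3 u2)
  · intro h x hx
    obtain ⟨t, t1, t2, rfl⟩ := (mem_cyclicIoo_iff h1 h2).1 hx
    obtain ⟨u, u1, u2, u3⟩ := h t (by omega) t2
    refine ⟨pt n u, (mem_cyclicIoo_iff h1 h2).2 ⟨u, by omega, u2, rfl⟩, ?_⟩
    rcases u3 with u3 | u3
    · exact ⟨(pt_ne_of_lt u3.1 u3.2.1).symm, u3.2.2.1⟩
    · exact ⟨pt_ne_of_lt u3.1 u3.2.1, π.symm' u3.2.2.1⟩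

/-- A half-pairing is determined by the set of its out points. -/
theorem eq_of_isOut_iff {π' : Setoid (Fin n)} (hπ' : IsHalfPairing π')
    (h : ∀ x, IsOut π x ↔ IsOut π' x) : π = π' := by
  have ho : ∀ j, Out (arcs π) j ↔ Out (arcs π') j := fun j => by
    rw [hπ.out_iff, hπ'.out_iff, h]
  have ha : ∀ i s, arcs π i s ↔ arcs π' i s := fun i s =>
    ⟨hπ.arcSystem.arc_of_out_iff hπ'.arcSystem ho,
      hπ'.arcSystem.arc_of_out_iff hπ.arcSystem fun j => (ho j).symm⟩
  ext x y
  by_cases hxy : y = x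
  · subst hxy
    exact ⟨fun _ => π'.refl' y, fun _ => π.refl' y⟩
  obtain ⟨s, s1, s2, rfl⟩ := exists_lift_of_ne (i := ((x : ℕ) : ℤ)) (x := y) (by rwa [pt_coe])
  have h1 := hπ.arcs_iff s1 s2
  have h2 := hπ'.arcs_iff s1 s2
  rw [pt_coe] at h1 h2
  rw [h1, h2, ha, ha]

end IsHalfPairing

namespace ArcSystem

variable {M : ℤ → ℤ → Prop} (hM : ArcSystem n M)

include hM

theorem joined_translate {i i' j : ℤ} (h : M i j ∨ M j i) (hi : pt n i = pt n i') :
    ∃ j', (M i' j' ∨ M j' i') ∧ pt n j' = pt n j := by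
  obtain ⟨c, rfl⟩ := exists_eq_add_mul hi.symm
  exact ⟨j + c * n, h.imp (hM.shift_mul · c) (hM.shift_mul · c), pt_add_mul _ _⟩

/-- The partition of `Fin n` into the pairs of points joined by an arc and the remaining points. -/
def toSetoid : Setoid (Fin n) where
  r x y := x = y ∨ ∃ i j, (M i j ∨ M j i) ∧ pt n i = x ∧ pt n j = y
  iseqv :=
    { refl := fun _ => Or.inl rfl
      symm := by
        rintro x y (h | ⟨i, j, h, hi, hj⟩)
        · exact Or.inl h.symm
        · exact Or.inr ⟨j, i, h.symm, hj, hi⟩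
      trans := by
        rintro x y z (rfl | ⟨i, j, h, rfl, rfl⟩) (rfl | ⟨j', k, h', hj', rfl⟩)
        · exact Or.inl rfl
        · exact Or.inr ⟨j', k, h', hj', rfl⟩
        · exact Or.inr ⟨i, j, h, rfl, rfl⟩
        · obtain ⟨k', hk', hk⟩ := hM.joined_translate h' hj'
          left
          rw [← hk, hM.joined_unique h.symm hk'] }

theorem toSetoid_iff {i s : ℤ} (h1 : i < s) (h2 : s < i + n) :
    hM.toSetoid (pt n i) (pt n s) ↔ M i s ∨ M s (i + n) := by
  constructor
  · rintro (h | ⟨i', j, h, hi, hj⟩)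
    · exact absurd h (pt_ne_of_lt h1 h2)
    · obtain ⟨j', h3, h4⟩ := hM.joined_translate h hi
      rw [hj] at h4
      rcases h3 with h3 | h3
      · left
        have a1 := hM.lt h3
        have a2 := hM.lt_add h3
        rwa [← eq_of_pt_eq h4 (by omega) (by omega)]
      · right
        have a1 := hM.lt h3
        have a2 := hM.lt_add h3
        have h5 := hM.shift h3
        rwa [eq_of_pt_eq (n := n) (i := j' + n) (j := s) (by rw [pt_add, h4]) (by omega)
          (by omega)] at h5
  · rintro (h | h)
    · exact Or.inr ⟨i, s, Or.inl h, rfl, rfl⟩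
    · exact Or.inr ⟨i + n, s, Or.inr h, pt_add i, rfl⟩

theorem isSingleton_toSetoid {a : ℤ} : IsSingleton hM.toSetoid (pt n a) ↔ Free M a := by
  constructor
  · intro h u
    constructor
    · intro hu
      exact pt_ne_of_lt (hM.lt hu) (hM.lt_add hu)
        (h _ (Or.inr ⟨a, u, Or.inl hu, rfl, rfl⟩)).symm
    · intro hu
      exact pt_ne_of_lt (hM.lt hu) (hM.lt_add hu)
        (h _ (Or.inr ⟨a, u, Or.inr hu, rfl, rfl⟩))
  · rintro h y (hy | ⟨i, j, hij, hi, rfl⟩)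
    · exact hy.symm
    · obtain ⟨j', h3, h4⟩ := hM.joined_translate hij hi
      rcases h3 with h3 | h3
      · exact absurd h3 (h _).1
      · exact absurd h3 (h _).2

/-- Two points on different sides of a pair of joined points are neither joined nor both free. -/
theorem not_crossing {i t s u : ℤ} (h1 : i < t) (h2 : t < s) (h3 : s < u) (h4 : u < i + n)
    (h : hM.toSetoid (pt n i) (pt n s)) : ¬ hM.toSetoid (pt n t) (pt n u) ∧
      ¬ (IsSingleton hM.toSetoid (pt n t) ∧ IsSingleton hM.toSetoid (pt n u)) := by
  rw [hM.toSetoid_iff (h2.trans h3) (by omega), hM.isSingleton_toSetoid, hM.isSingleton_toSetoid]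
  rcases (hM.toSetoid_iff (h1.trans h2) (by omega)).1 h with h | h
  · refine ⟨?_, fun hf => hM.not_free_of_arc h h1.le h2.le hf.1⟩
    obtain ⟨v, v1, v2, v3⟩ := hM.interior h h1 h2
    rintro (h5 | h5)
    · have := hM.joined_unique v3 (Or.inl h5)
      omega
    · have h6 := hM.unshift h5
      rw [add_sub_cancel_right] at h6
      have := hM.joined_unique v3 (Or.inr h6)
      omega
  · refine ⟨?_, fun hf => hM.not_free_of_arc h h3.le h4.le hf.2⟩
    obtain ⟨v, v1, v2, v3⟩ := hM.interior h h3 h4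
    rintro (h5 | h5)
    · have := hM.joined_unique v3 (Or.inr h5)
      omega
    · have := hM.joined_unique v3 (Or.inl h5)
      omega

theorem isHalfPairing : IsHalfPairing hM.toSetoid where
  nonCrossing := by
    intro x y z t h1 h2 h3 hxz hyt
    have h := hM.not_crossing (i := ((x : ℕ) : ℤ)) (t := ((y : ℕ) : ℤ)) (s := ((z : ℕ) : ℤ))
      (u := ((t : ℕ) : ℤ)) (by omega) (by omega) (by omega) (by omega)
    simp only [pt_coe] at h
    exact absurd hyt (h hxz).1
  card_le_two := by
    rintro x y z (h | ⟨i, j, h, rfl, rfl⟩) (h' | ⟨i', j', h', hi, rfl⟩)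
    · exact Or.inl h
    · exact Or.inl h
    · exact Or.inr (Or.inl h')
    · obtain ⟨k, hk, hk'⟩ := hM.joined_translate h' hi
      exact Or.inr (Or.inr (by rw [← hk', hM.joined_unique h hk]))
  exists_singleton := by
    obtain ⟨a, ha⟩ := hM.exists_free
    exact ⟨pt n a, hM.isSingleton_toSetoid.2 ha⟩
  nonCrossing_join := by
    intro x y z t h1 h2 h3 hxz hyt
    have h := hM.not_crossing (i := ((x : ℕ) : ℤ)) (t := ((y : ℕ) : ℤ)) (s := ((z : ℕ) : ℤ))
      (u := ((t : ℕ) : ℤ)) (by omega) (by omega) (by omega) (by omega)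
    have h' := hM.not_crossing (i := ((y : ℕ) : ℤ)) (t := ((z : ℕ) : ℤ)) (s := ((t : ℕ) : ℤ))
      (u := ((x : ℕ) : ℤ) + n) (by omega) (by omega) (by omega) (by omega)
    simp only [pt_coe, pt_add] at h h'
    rcases hxz with hxz | hxz
    · rcases hyt with hyt | hyt
      · exact absurd hyt (h hxz).1
      · exact absurd hyt (h hxz).2
    · rcases hyt with hyt | hyt
      · exact absurd hxz.symm (h' hyt).2
      · exact Or.inr ⟨hxz.1, hyt.1⟩

/-- A pair remembers which of its two sides carries the arc, because some free point lies on the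
other side. -/
theorem arcs_toSetoid {i s : ℤ} : arcs hM.toSetoid i s ↔ M i s := by
  constructor
  · rintro ⟨h1, h2, h3, h4⟩
    rcases (hM.toSetoid_iff h1 h2).1 h3 with h | h
    · exact h
    · exfalso
      obtain ⟨a, ha⟩ := hM.exists_free
      obtain ⟨t, t1, t2, t3⟩ := exists_lift i (pt n a)
      have hsing : IsSingleton hM.toSetoid (pt n t) := by
        rw [t3, hM.isSingleton_toSetoid]
        exact ha
      rcases le_or_gt t s with h5 | h5
      · exact h4 t t1 h5 hsing
      · exact hM.not_free_of_arc h h5.le t2.le (hM.isSingleton_toSetoid.1 hsing)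
  · intro h
    refine ⟨hM.lt h, hM.lt_add h, Or.inr ⟨i, s, Or.inl h, rfl, rfl⟩, fun t t1 t2 ht => ?_⟩
    exact hM.not_free_of_arc h t1 t2 (hM.isSingleton_toSetoid.1 ht)

theorem isOut_toSetoid {j : ℤ} : IsOut hM.toSetoid (pt n j) ↔ Out M j := by
  rw [← hM.isHalfPairing.out_iff]
  simp only [Out, hM.arcs_toSetoid]

end ArcSystem

end Lift

/-! ### Height functions and the arcs below them -/

section Heights

theorem Int.exists_first {P : ℤ → Prop} {a b : ℤ} (hab : a ≤ b) (hb : P b) :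
    ∃ c, a ≤ c ∧ c ≤ b ∧ P c ∧ ∀ t, a ≤ t → t < c → ¬ P t := by
  classical
  obtain ⟨c, ⟨c1, c2⟩, c3⟩ := Int.exists_least_of_bdd (P := fun z => a ≤ z ∧ P z)
    ⟨a, fun z hz => hz.1⟩ ⟨b, hab, hb⟩
  refine ⟨c, c1, c3 b ⟨hab, hb⟩, c2, fun t t1 t2 ht => ?_⟩
  have := c3 t ⟨t1, ht⟩
  omega

theorem Int.exists_last {P : ℤ → Prop} {a b : ℤ} (hab : a ≤ b) (ha : P a) :
    ∃ c, a ≤ c ∧ c ≤ b ∧ P c ∧ ∀ t, c < t → t ≤ b → ¬ P t := by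
  classical
  obtain ⟨c, ⟨c1, c2⟩, c3⟩ := Int.exists_greatest_of_bdd (P := fun z => z ≤ b ∧ P z)
    ⟨b, fun z hz => hz.1⟩ ⟨a, hab, ha⟩
  refine ⟨c, c3 a ⟨hab, ha⟩, c1, c2, fun t t1 t2 ht => ?_⟩
  have := c3 t ⟨t2, ht⟩
  omega

/-- Paths with steps `±1` which gain the height `k > 0` in each period of length `n`. -/
structure IsHeight (n : ℕ) (k : ℤ) (h : ℤ → ℤ) : Prop where
  pos : 0 < k
  step : ∀ j, h (j + 1) = h j + 1 ∨ h (j + 1) = h j - 1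
  period : ∀ j, h (j + n) = h j + k

/-- The arcs below the path `h`: an up step is joined to the first step which returns to the height
where it started. -/
def heightArcs (h : ℤ → ℤ) (i s : ℤ) : Prop :=
  i < s ∧ h (s + 1) = h i ∧ ∀ t, i < t → t ≤ s → h i < h t

namespace IsHeight

variable {n : ℕ} {k : ℤ} {h : ℤ → ℤ} (hh : IsHeight n k h)

include hh

theorem period_sub (j : ℤ) : h (j - n) = h j - k := by
  have := hh.period (j - n)
  rw [sub_add_cancel] at this
  omega

theorem period_mul (j : ℤ) (c : ℕ) : h (j + c * n) = h j + c * k := by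
  induction c with
  | zero => simp
  | succ c ih =>
    have := hh.period (j + c * n)
    rw [ih] at this
    push_cast
    rw [add_mul, add_mul, one_mul, one_mul, ← add_assoc, this]
    ring

theorem n_pos : 0 < n := by
  by_contra h0
  obtain rfl : n = 0 := by omega
  have := hh.period 0
  have := hh.pos
  simp_all

/-- The first time after `i` at height at most `h i` is at height exactly `h i`, the steps being
`±1`; the arc ends with the step leading there. -/
theorem exists_arc_of_up {i j : ℤ} (hu : h (i + 1) = h i + 1) (hij : i < j) (hj : h j < h i) :
    ∃ s, i < s ∧ s < j - 1 ∧ heightArcs h i s := by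
  obtain ⟨c, c1, c2, c3, c4⟩ := Int.exists_first (P := fun z => h z ≤ h i) (a := i + 1)
    (by omega) hj.le
  have hne : c ≠ i + 1 := by
    rintro rfl
    omega
  have h1 := c4 (c - 1) (by omega) (by omega)
  have h2 := hh.step (c - 1)
  rw [sub_add_cancel] at h2
  have hcj : c ≠ j := by
    rintro rfl
    omega
  refine ⟨c - 1, by omega, by omega, by omega, by rw [sub_add_cancel]; omega, fun t t1 t2 => ?_⟩
  have := c4 t (by omega) (by omega)
  omega

/-- Mirror image: the arc starts at the last time up to `s` at which the path was not higher than `h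
(s + 1)`. -/
theorem exists_arc_of_down {a s : ℤ} (hd : h (s + 1) = h s - 1) (has : a ≤ s)
    (ha : h a ≤ h (s + 1)) : ∃ i, a ≤ i ∧ i < s ∧ heightArcs h i s := by
  obtain ⟨c, c1, c2, c3, c4⟩ := Int.exists_last (P := fun z => h z ≤ h (s + 1)) has ha
  have hne : c ≠ s := by
    rintro rfl
    omega
  have h1 := c4 (c + 1) (by omega) (by omega)
  have h2 := hh.step c
  have h3 : h (s + 1) = h c := by omega
  refine ⟨c, c1, by omega, by omega, h3, fun t t1 t2 => ?_⟩
  have := c4 t t1 t2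
  omega

/-- One period earlier the path was lower by `k > 0`, so every down step closes an arc opened by an
earlier up step. -/
theorem out_iff {j : ℤ} : Out (heightArcs h) j ↔ h (j + 1) = h j + 1 := by
  constructor
  · intro ho
    rcases hh.step j with h1 | h1
    · exact h1
    · have hk := hh.pos
      have hn := hh.n_pos
      have h2 := hh.period_sub (j + 1)
      obtain ⟨i, -, -, hi⟩ := hh.exists_arc_of_down (a := j + 1 - n) h1 (by omega) (by omega)
      exact absurd hi (ho i)
  · rintro h1 i ⟨h2, h3, h4⟩
    have := h4 j h2 le_rfl
    omega

theorem exists_free : ∃ a, Free (heightArcs h) a := by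
  have hn : (0 : ℤ) < n := by exact_mod_cast hh.n_pos
  have hk := hh.pos
  -- As `0 ≤ j < n`, minimising `n * h j - j` picks the last of the lowest points of the period. The
  -- path stays strictly above `h a` afterwards, so the up step at `a` is never matched.
  obtain ⟨a, ha, hmin⟩ := (Finset.Ico (0 : ℤ) n).exists_min_image (fun j => n * h j - j)
    ⟨0, by simp [hh.n_pos]⟩
  simp only [Finset.mem_Ico] at ha hmin
  have h1 : ∀ t, a < t → h a < h t := by
    intro t hat
    have hr0 := Int.emod_nonneg t hn.ne'
    have hr1 := Int.emod_lt_of_pos t hn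
    have hm := hmin (t % n) ⟨hr0, hr1⟩
    have hdiv : t = t % n + (t / n).toNat * n := by
      have h2 : 0 ≤ t / n := Int.ediv_nonneg (by omega) hn.le
      rw [Int.toNat_of_nonneg h2]
      have := Int.emod_add_mul_ediv t n
      linarith
    have hp := hh.period_mul (t % n) (t / n).toNat
    rw [← hdiv] at hp
    rcases Nat.eq_zero_or_pos (t / n).toNat with h0 | h0
    · rw [h0] at hdiv
      have e : t % n = t := by omega
      rw [e] at hm
      nlinarith
    · have h2 : h a ≤ h (t % n) := by
        by_contra hcon
        nlinarith
      have h3 : 1 ≤ ((t / n).toNat : ℤ) := by omega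
      nlinarith
  refine ⟨a, fun u => ⟨?_, ?_⟩⟩
  · rintro ⟨u1, u2, u3⟩
    have := h1 (u + 1) (by omega)
    omega
  · rintro ⟨u1, u2, u3⟩
    have := h1 (a + 1) (by omega)
    have := u3 a u1 le_rfl
    omega

theorem arcSystem : ArcSystem n (heightArcs h) where
  lt h1 := h1.1
  lt_add := by
    rintro i s ⟨h1, h2, h3⟩
    -- An arc of length at least `n` would pass over `s + 1 - n`, where the height is `h i - k`.
    by_contra hcon
    have h4 := h3 (s + 1 - n) (by omega) (by have := hh.n_pos; omega)
    have h5 := hh.period_sub (s + 1)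
    have := hh.pos
    omega
  shift := by
    rintro i s ⟨h1, h2, h3⟩
    refine ⟨by omega, ?_, fun t t1 t2 => ?_⟩
    · rw [show s + n + 1 = s + 1 + n by ring, hh.period, hh.period, h2]
    · have h4 := h3 (t - n) (by omega) (by omega)
      rw [hh.period_sub] at h4
      rw [hh.period]
      omega
  unshift := by
    rintro i s ⟨h1, h2, h3⟩
    refine ⟨by omega, ?_, fun t t1 t2 => ?_⟩
    · rw [show s - n + 1 = s + 1 - n by ring, hh.period_sub, hh.period_sub, h2]
    · have h4 := h3 (t + n) (by omega) (by omega)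
      rw [hh.period] at h4
      rw [hh.period_sub]
      omega
  left_unique := by
    rintro i s s' ⟨h1, h2, h3⟩ ⟨h1', h2', h3'⟩
    rcases lt_trichotomy s s' with h4 | h4 | h4
    · have := h3' (s + 1) (by omega) (by omega)
      omega
    · exact h4
    · have := h3 (s' + 1) (by omega) (by omega)
      omega
  right_unique := by
    rintro i i' s ⟨h1, h2, h3⟩ ⟨h1', h2', h3'⟩
    rcases lt_trichotomy i i' with h4 | h4 | h4
    · have := h3 i' (by omega) (by omega)
      omega
    · exact h4
    · have := h3' i (by omega) (by omega)
      omega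
  not_left := by
    rintro i s t ⟨h1, h2, h3⟩ ⟨h1', h2', h3'⟩
    have := h3 s h1 le_rfl
    have := h3' (s + 1) (by omega) (by omega)
    omega
  interior := by
    rintro i s t ⟨h1, h2, h3⟩ it ts
    have ht := h3 t it ts.le
    rcases hh.step t with h4 | h4
    · obtain ⟨u, u1, u2, u3⟩ := hh.exists_arc_of_up h4 (j := s + 1) (by omega) (by omega)
      exact ⟨u, by omega, by omega, Or.inl u3⟩
    · have ht' := h3 (t + 1) (by omega) (by omega)
      obtain ⟨u, u1, u2, u3⟩ := hh.exists_arc_of_down h4 it.le ht'.le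
      refine ⟨u, lt_of_le_of_ne u1 ?_, by omega, Or.inr u3⟩
      rintro rfl
      have := u3.2.1
      omega
  exists_free := hh.exists_free

end IsHeight

variable {n : ℕ} [NeZero n]

/-- The path on `Fin n`, extended periodically, which goes down at the points of `I`. -/
noncomputable def setHeight (I : Finset (Fin n)) (j : ℤ) : ℤ :=
  (j / n) * (n - 2 * I.card) +
    ∑ t ∈ Finset.range (j % n).toNat, if pt n t ∈ I then (-1 : ℤ) else 1

theorem sum_range_sign (I : Finset (Fin n)) :
    ∑ t ∈ Finset.range n, (if pt n t ∈ I then (-1 : ℤ) else 1) = n - 2 * I.card := by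
  rw [Finset.sum_range]
  simp only [pt_coe]
  rw [Finset.sum_ite]
  simp only [Finset.sum_const, Finset.filter_mem_eq_inter, Finset.univ_inter]
  have : (Finset.univ.filter fun x => x ∉ I) = Iᶜ := by ext; simp
  rw [this, Finset.card_compl, Fintype.card_fin]
  have := Finset.card_le_univ I
  rw [Fintype.card_fin] at this
  simp
  omega

theorem setHeight_succ (I : Finset (Fin n)) (j : ℤ) :
    setHeight I (j + 1) = setHeight I j + if pt n j ∈ I then (-1 : ℤ) else 1 := by
  have hn : (0 : ℤ) < n := by exact_mod_cast Nat.pos_of_neZero n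
  have hr0 := Int.emod_nonneg j hn.ne'
  have hr1 := Int.emod_lt_of_pos j hn
  have hdiv := Int.emod_add_mul_ediv j n
  have hpt : pt n (((j % n).toNat : ℕ) : ℤ) = pt n j := by
    rw [Int.toNat_of_nonneg hr0, pt_eq_iff, Int.emod_emod]
  have hsum : ∑ t ∈ Finset.range ((j % n).toNat + 1), (if pt n t ∈ I then (-1 : ℤ) else 1)
      = ∑ t ∈ Finset.range (j % n).toNat, (if pt n t ∈ I then (-1 : ℤ) else 1)
        + if pt n j ∈ I then (-1 : ℤ) else 1 := by
    rw [Finset.sum_range_succ, hpt]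
  rcases lt_or_ge (j % n + 1) n with h | h
  · have e : (j + 1) / n = j / n ∧ (j + 1) % n = j % n + 1 := by
      rw [Int.ediv_emod_unique hn]
      exact ⟨by linarith, by omega, h⟩
    rw [setHeight, e.1, e.2, show (j % n + 1).toNat = (j % n).toNat + 1 by omega, hsum, setHeight]
    ring
  · have e : (j + 1) / n = j / n + 1 ∧ (j + 1) % n = 0 := by
      rw [Int.ediv_emod_unique hn]
      exact ⟨by linarith, by omega, hn⟩
    rw [show (j % n).toNat + 1 = n by omega, sum_range_sign] at hsum
    rw [setHeight, e.1, e.2, setHeight]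
    simp only [Int.toNat_zero, Finset.range_zero, Finset.sum_empty]
    linarith

theorem isHeight_setHeight {I : Finset (Fin n)} (hI : 2 * I.card < n) :
    IsHeight n (n - 2 * I.card) (setHeight I) where
  pos := by omega
  step j := by
    rw [setHeight_succ]
    split_ifs
    · exact Or.inr rfl
    · exact Or.inl rfl
  period j := by
    have hn : (n : ℤ) ≠ 0 := by exact_mod_cast NeZero.ne n
    rw [setHeight, setHeight, Int.add_emod_right, Int.add_ediv_of_dvd_right (dvd_refl _),
      Int.ediv_self hn]
    ring

/-- Every small set is the complement of the out points of a half-pairing. -/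
theorem exists_halfPairing {I : Finset (Fin n)} (hI : 2 * I.card < n) :
    ∃ π : Setoid (Fin n), IsHalfPairing π ∧ ∀ x, IsOut π x ↔ x ∉ I := by
  have hh := isHeight_setHeight hI
  refine ⟨hh.arcSystem.toSetoid, hh.arcSystem.isHalfPairing, fun x => ?_⟩
  have := hh.arcSystem.isOut_toSetoid (j := ((x : ℕ) : ℤ))
  rw [hh.out_iff, setHeight_succ, pt_coe] at this
  rw [this]
  split_ifs with h <;> simp [h]

end Heights

/-! ### Consecutive, first and last entries of sorted lists -/

section SortedLists

variable {α : Type*} [LinearOrder α]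

theorem isChain_iff_of_sorted {R : α → α → Prop} {l : List α} (hl : l.Pairwise (· < ·)) :
    l.IsChain R ↔ ∀ i ∈ l, ∀ j ∈ l, i < j → (∀ x ∈ l, i < x → ¬ x < j) → R i j := by
  induction l with
  | nil => simp
  | cons a l ih =>
    rw [List.pairwise_cons] at hl
    rw [List.isChain_cons, ih hl.2]
    constructor
    · rintro ⟨h1, h2⟩ i hi j hj hij hx
      have hj' : j ∈ l := by
        rcases List.mem_cons.1 hj with rfl | hj
        · rcases List.mem_cons.1 hi with rfl | hi
          · exact absurd hij (lt_irrefl _)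
          · exact absurd (hl.1 _ hi) hij.asymm
        · exact hj
      rcases List.mem_cons.1 hi with rfl | hi
      · apply h1
        cases l with
        | nil => simp at hj'
        | cons b l =>
          rcases List.mem_cons.1 hj' with rfl | hj''
          · simp
          · exact absurd ((List.pairwise_cons.1 hl.2).1 _ hj'') (hx b (by simp) (hl.1 b (by simp)))
      · exact h2 i hi j hj' hij fun x hxl => hx x (List.mem_cons_of_mem _ hxl)
    · intro h
      constructor
      · intro y hy
        cases l with
        | nil => simp at hy
        | cons b l =>
          simp only [List.head?_cons, Option.mem_def, Option.some.injEq] at hy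
          subst hy
          refine h a (by simp) b (by simp) (hl.1 b (by simp)) fun x hx hax hxb => ?_
          rcases List.mem_cons.1 hx with rfl | hx
          · exact lt_irrefl _ hax
          rcases List.mem_cons.1 hx with rfl | hx
          · exact lt_irrefl _ hxb
          · exact hxb.asymm ((List.pairwise_cons.1 hl.2).1 _ hx)
      · intro i hi j hj hij hx
        refine h i (List.mem_cons_of_mem _ hi) j (List.mem_cons_of_mem _ hj) hij fun x hxl h1 => ?_
        rcases List.mem_cons.1 hxl with rfl | hxl
        · exact absurd (hl.1 _ hi) h1.asymm
        · exact hx x hxl h1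

theorem head?_eq_of_sorted {l : List α} (hl : l.Pairwise (· < ·)) {a : α} (ha : a ∈ l)
    (h : ∀ x ∈ l, a ≤ x) : l.head? = some a := by
  cases l with
  | nil => simp at ha
  | cons b l =>
    rcases List.mem_cons.1 ha with rfl | ha
    · rfl
    · exact absurd ((List.pairwise_cons.1 hl).1 _ ha) (h b (by simp)).not_gt

theorem getLast?_eq_of_sorted {l : List α} (hl : l.Pairwise (· < ·)) {a : α} (ha : a ∈ l)
    (h : ∀ x ∈ l, x ≤ a) : l.getLast? = some a := by
  rcases List.eq_nil_or_concat l with rfl | ⟨l', b, rfl⟩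
  · simp at ha
  · simp only [List.concat_eq_append] at *
    rcases List.mem_append.1 ha with ha | ha
    · exact absurd ((List.pairwise_append.1 hl).2.2 _ ha b (by simp)) (h b (by simp)).not_gt
    · simp only [List.mem_singleton] at ha
      simp [ha]

end SortedLists

/-! ### The word at the free points as a cyclic reduction -/

section CyclicReduction

variable {N n : ℕ} {M : ℤ → ℤ → Prop}

/-- Arcs do not pass over free points, so an arc with one end between `i` and `j` has the other end
there too. -/
theorem ArcSystem.balanced_of_free (hM : ArcSystem n M) {i j : ℤ} (hi : Free M i) (hj : Free M j)
    (h : ∀ t, i < t → t < j → ¬ Free M t) : Balanced M (i + 1) j := by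
  intro t t1 t2
  have h1 := h t (by omega) t2
  simp only [Free, not_forall] at h1
  obtain ⟨u, hu⟩ := h1
  have hu' : M t u ∨ M u t := by tauto
  refine ⟨u, ?_, ?_, hu'⟩
  · by_contra hcon
    rcases hu' with h2 | h2
    · have := hM.lt h2
      omega
    · exact hM.not_free_of_arc h2 (t := i) (by omega) (by omega) hi
  · by_contra hcon
    rcases hu' with h2 | h2
    · exact hM.not_free_of_arc h2 (t := j) (by omega) (by omega) hj
    · have := hM.lt h2
      omega

/-- The free points of a period, in increasing order. -/
theorem freeLetters_eq (L : ℤ → Letter N) (a : ℤ) (m : ℕ) :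
    ∃ l : List ℤ, l.Pairwise (· < ·) ∧ (∀ t, t ∈ l ↔ a ≤ t ∧ t < a + m ∧ Free M t) ∧
      freeLetters M L a m = l.map L := by
  classical
  refine ⟨((List.range m).map fun t : ℕ => a + t).filter fun t => Free M t, ?_, ?_, ?_⟩
  · apply List.Pairwise.filter
    rw [List.pairwise_map]
    refine List.pairwise_lt_range.imp ?_
    intro x y hxy
    omega
  · intro t
    simp only [List.mem_filter, List.mem_map, List.mem_range, decide_eq_true_eq]
    constructor
    · rintro ⟨⟨x, hx, rfl⟩, hf⟩
      exact ⟨by omega, by omega, hf⟩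
    · rintro ⟨h1, h2, h3⟩
      exact ⟨⟨(t - a).toNat, by omega, by omega⟩, h3⟩
  · rw [freeLetters]

theorem segment_shift {L : ℤ → Letter N} (hL : ∀ j, L (j + n) = L j) (a : ℤ) (m : ℕ) :
    segment L (a + n) m = segment L a m := by
  simp only [segment]
  congr 1
  funext t
  rw [← hL (a + t)]
  congr 1
  ring

variable [NeZero n]

theorem ArcSystem.free_pt (hM : ArcSystem n M) {i j : ℤ} (h : pt n i = pt n j) (hi : Free M i) :
    Free M j := by
  obtain ⟨c, rfl⟩ := exists_eq_add_mul h.symm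
  rcases Int.eq_nat_or_neg c with ⟨c, rfl | rfl⟩
  · exact hM.free_shift_mul hi c
  · have := hM.free_unshift_mul hi c
    rwa [neg_mul, ← sub_eq_add_neg]

/-- The first and the last free point of a period. -/
theorem ArcSystem.exists_first_last_free (hM : ArcSystem n M) :
    ∃ p q : ℤ, 0 ≤ p ∧ p ≤ q ∧ q < n ∧ Free M p ∧ Free M q ∧
      (∀ t, 0 ≤ t → t < p → ¬ Free M t) ∧ ∀ t, q < t → t < n → ¬ Free M t := by
  obtain ⟨a, ha⟩ := hM.exists_free
  obtain ⟨b, b1, b2, b3⟩ := exists_lift 0 (pt n a)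
  have hb : Free M b := hM.free_pt b3.symm ha
  obtain ⟨p, p1, p2, p3, p4⟩ := Int.exists_first (P := Free M) b1 hb
  obtain ⟨q, q1, q2, q3, q4⟩ := Int.exists_last (P := Free M) (a := b) (b := n - 1) (by omega) hb
  exact ⟨p, q, p1, by omega, by omega, p3, q3, p4, fun t t1 t2 => q4 t t1 (by omega)⟩

/-- The word at the free points is cyclically reduced if and only if the letters at consecutive free
points do not cancel. -/
theorem isCyclicallyReduced_freeLetters (hM : ArcSystem n M) {L : ℤ → Letter N}
    (hL : ∀ j, L (j + n) = L j) :
    FreeGroup.IsCyclicallyReduced (freeLetters M L 0 n) ↔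
      ∀ i j, i < j → Free M i → Free M j → Balanced M (i + 1) j → L i ≠ (L j).inv := by
  obtain ⟨p, q, p0, pq, qn, hp, hq, hp', hq'⟩ := hM.exists_first_last_free
  obtain ⟨l, l1, l2, l3⟩ := freeLetters_eq (M := M) L 0 n
  simp only [zero_add] at l2
  have hhead : l.head? = some p := by
    refine head?_eq_of_sorted l1 ((l2 p).2 ⟨p0, by omega, hp⟩) fun x hx => ?_
    rw [l2] at hx
    by_contra hcon
    exact hp' x hx.1 (by omega) hx.2.2
  have hlast : l.getLast? = some q := by
    refine getLast?_eq_of_sorted l1 ((l2 q).2 ⟨by omega, by omega, hq⟩) fun x hx => ?_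
    rw [l2] at hx
    by_contra hcon
    exact hq' x (by omega) hx.2.1 hx.2.2
  rw [l3, FreeGroup.isCyclicallyReduced_iff, FreeGroup.IsReduced, List.isChain_map,
    isChain_iff_of_sorted l1, List.head?_map, List.getLast?_map, hhead, hlast]
  simp only [← Letter.ne_inv_iff, Option.map_some, Option.mem_def, Option.some.injEq,
    forall_eq']
  constructor
  · rintro ⟨h1, h2⟩ i j hij hi hj hb
    -- Otherwise the free point `i + n` would lie in the balanced interval.
    have hjn : j ≤ i + n := by
      by_contra hcon
      have := Nat.pos_of_neZero n
      exact hb.not_free (t := i + n) (by omega) (by omega) (hM.free_shift hi)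
    obtain ⟨c, c1, c2⟩ := exists_translate (n := n) i
    have hL' : ∀ t, L (t + c * n) = L t := by
      have hLn : ∀ (t : ℤ) (c : ℕ), L (t + c * n) = L t := by
        intro t c
        induction c with
        | zero => simp
        | succ c ih => rw [← ih, ← hL (t + c * n)]; congr 1; push_cast; ring
      intro t
      rcases Int.eq_nat_or_neg c with ⟨c, rfl | rfl⟩
      · exact hLn t c
      · rw [← hLn _ c]; congr 1; ring
    have hi' : Free M (i + c * n) := hM.free_pt (pt_add_mul i c).symm hi
    have hj' : Free M (j + c * n) := hM.free_pt (pt_add_mul j c).symm hj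
    have hb' : ∀ t, i + c * n < t → t < j + c * n → ¬ Free M t := by
      intro t t1 t2 hf
      refine hb.not_free (t := t - c * n) (by omega) (by omega) (hM.free_pt ?_ hf)
      conv_lhs => rw [← sub_add_cancel t (c * n), pt_add_mul]
    rw [← hL' i, ← hL' j]
    rcases lt_or_ge (j + c * n) n with h3 | h3
    · exact h1 _ ((l2 _).2 ⟨c1, c2, hi'⟩) _ ((l2 _).2 ⟨by omega, h3, hj'⟩) (by omega)
        fun x hx x1 x2 => hb' x x1 x2 ((l2 x).1 hx).2.2
    -- Consecutive free points straddling the end of the period are the last of this period and the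
    -- first of the next; this is the condition on the last and the first letter.
    · have hiq : i + c * n = q := by
        by_contra hne
        have : i + c * n < q := by
          by_contra hcon
          exact hq' _ (by omega) c2 hi'
        exact hb' q this (by omega) hq
      have hjp : j + c * n = p + n := by
        have hj'' := hM.free_unshift hj'
        by_contra hne
        have : p + n < j + c * n := by
          by_contra hcon
          exact hp' _ (by omega) (by omega) hj''
        exact hb' (p + n) (by omega) this (hM.free_shift hp)
      rw [hiq, hjp, hL]
      exact h2
  · intro h
    refine ⟨fun i hi j hj hij hx => ?_, ?_⟩
    · rw [l2] at hi hj
      refine h i j hij hi.2.2 hj.2.2 (hM.balanced_of_free hi.2.2 hj.2.2 fun t t1 t2 hf => ?_)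
      exact hx t ((l2 t).2 ⟨by omega, by omega, hf⟩) t1 t2
    · rw [← hL p]
      have hp1 := hM.free_shift hp
      refine h q (p + n) (by omega) hq hp1 (hM.balanced_of_free hq hp1 fun t t1 t2 hf => ?_)
      rcases lt_or_ge t n with h3 | h3
      · exact hq' t t1 h3 hf
      · exact hp' (t - n) (by omega) (by omega) (hM.free_unshift hf)

/-- A periodic word whose letters at the ends of arcs are inverse to each other reduces cyclically to
the word at the free points. -/
theorem reflTransGen_freeLetters (hM : ArcSystem n M) {L : ℤ → Letter N}
    (hL : ∀ j, L (j + n) = L j) (hLM : ∀ i s, M i s → L s = (L i).inv)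
    (hred : FreeGroup.IsReduced (freeLetters M L 0 n)) :
    Relation.ReflTransGen CyclicStep (segment L 0 n) (freeLetters M L 0 n) := by
  obtain ⟨p, q, p0, pq, qn, hp, hq, hp', hq'⟩ := hM.exists_first_last_free
  -- Cut the period before its first and after its last free point. The two outer pieces, read
  -- across the period boundary, form a balanced interval; the middle piece carries all free
  -- letters.
  have e1 : n = p.toNat + (q + 1 - p).toNat + (n - (q + 1)).toNat := by omega
  have hseg : segment L 0 n = segment L 0 p.toNat ++ segment L p (q + 1 - p).toNat ++
      segment L (q + 1) (n - (q + 1)).toNat := by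
    conv_lhs => rw [e1, segment_add, segment_add]
    rw [show (0 : ℤ) + ((p.toNat + (q + 1 - p).toNat : ℕ) : ℤ) = q + 1 by omega,
      show (0 : ℤ) + (p.toNat : ℤ) = p by omega]
  have hfree : freeLetters M L 0 n = freeLetters M L p (q + 1 - p).toNat := by
    conv_lhs => rw [e1, freeLetters_add, freeLetters_add]
    rw [show (0 : ℤ) + ((p.toNat + (q + 1 - p).toNat : ℕ) : ℤ) = q + 1 by omega,
      show (0 : ℤ) + (p.toNat : ℤ) = p by omega,
      freeLetters_eq_nil L (a := 0) (fun t t1 t2 => hp' t t1 (by omega)),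
      freeLetters_eq_nil L (a := q + 1) (fun t t1 t2 => hq' t (by omega) (by omega))]
    simp
  rw [hfree] at hred ⊢
  rw [hseg]
  refine reflTransGen_cyclicStep_wrap ?_ hred ?_
  · rw [mk_freeLetters hM L hLM (by omega)]
    · rfl
    · intro t t1 t2
      by_cases hf : Free M t
      · exact Or.inl hf
      right
      simp only [Free, not_forall] at hf
      obtain ⟨u, hu⟩ := hf
      have hu' : M t u ∨ M u t := by tauto
      refine ⟨u, ?_, ?_, hu'⟩
      · by_contra hcon
        rcases hu' with h2 | h2
        · have := hM.lt h2
          omega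
        · exact hM.not_free_of_arc h2 (t := p) (by omega) (by omega) hp
      · by_contra hcon
        rcases hu' with h2 | h2
        · exact hM.not_free_of_arc h2 (t := q) (by omega) (by omega) hq
        · have := hM.lt h2
          omega
  · have hp1 := hM.free_shift hp
    have hb := hM.balanced_of_free hq hp1 fun t t1 t2 hf => by
      rcases lt_or_ge t n with h3 | h3
      · exact hq' t t1 h3 hf
      · exact hp' (t - n) (by omega) (by omega) (hM.free_unshift hf)
    have h1 := segProd_balanced hM L (by omega) (fun i s _ _ => hLM i s) hb
    rw [segProd, show (p + n - (q + 1)).toNat = (n - (q + 1)).toNat + p.toNat by omega,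
      segment_add, show q + 1 + (((n - (q + 1)).toNat : ℕ) : ℤ) = 0 + n by omega,
      segment_shift hL] at h1
    exact h1

theorem segment_word (w : Word N n) : segment (fun j => w (pt n j)) 0 n = List.ofFn w := by
  rw [segment, ← List.map_coe_finRange_eq_range, List.map_map, List.ofFn_eq_map]
  refine List.map_congr_left fun x _ => ?_
  simp [pt_coe]

theorem freeLetters_word {π : Setoid (Fin n)} (hπ : IsHalfPairing π) (w : Word N n) :
    freeLetters (arcs π) (fun j => w (pt n j)) 0 n = throughWord w π := by
  classical
  rw [freeLetters, throughWord, ← List.map_coe_finRange_eq_range, List.map_map, List.filter_map,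
    List.map_map]
  simp only [zero_add, Function.comp_def, pt_coe, hπ.free_iff]

/-- The conditions on the letters of an admissible word, in terms of arcs. -/
theorem labels_iff {π : Setoid (Fin n)} (hπ : IsHalfPairing π) (w : Word N n) :
    ((∀ r s, r ≠ s → π r s → w r = (w s).inv) ∧ ∀ i j, Covers π i j → w i ≠ (w j).inv) ↔
      (∀ i s, arcs π i s → w (pt n s) = (w (pt n i)).inv) ∧
      ∀ i j, i < j → Out (arcs π) i → Out (arcs π) j → Balanced (arcs π) (i + 1) j →
        w (pt n i) ≠ (w (pt n j)).inv := by
  have hM := hπ.arcSystem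
  constructor
  · rintro ⟨h1, h2⟩
    refine ⟨fun i s h => h1 _ _ (pt_ne_of_lt h.1 h.2.1).symm (π.symm' h.2.2.1),
      fun i j hij hi hj hb => ?_⟩
    have hjn : j ≤ i + n := by
      by_contra hcon
      obtain ⟨a, ha⟩ := hM.exists_free
      obtain ⟨b, b1, b2, b3⟩ := exists_lift (i + 1) (pt n a)
      exact hb.not_free b1 (by omega) (hM.free_pt b3.symm ha)
    exact h2 _ _ ((hπ.covers_iff hij hjn).2 ⟨hi, hj, hb⟩)
  · rintro ⟨h1, h2⟩
    constructor
    · intro r s hrs h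
      obtain ⟨t, t1, t2, rfl⟩ := exists_lift_of_ne (i := ((r : ℕ) : ℤ)) (x := s)
        (by rw [pt_coe]; exact hrs.symm)
      have h3 := hπ.arcs_or_arcs t1 t2
      rw [pt_coe] at h3
      rcases h3 h with h4 | h4
      · rw [h1 _ _ h4, pt_coe, Letter.inv_inv]
      · have := h1 _ _ h4
        rwa [pt_add, pt_coe] at this
    · intro x y hxy
      obtain ⟨j, j1, j2, rfl⟩ := exists_lift (((x : ℕ) : ℤ) + 1) y
      rw [← pt_coe x] at hxy ⊢
      obtain ⟨h3, h4, h5⟩ := (hπ.covers_iff (by omega) (by omega)).1 hxy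
      exact h2 _ _ (by omega) h3 h4 h5

/-- The condition that the word at the singletons is a cyclic reduction follows from the others. -/
theorem isAdmissible_iff_labels {π : Setoid (Fin n)} (hπ : IsHalfPairing π) (w : Word N n) :
    IsAdmissible w π ↔
      (∀ r s, r ≠ s → π r s → w r = (w s).inv) ∧ ∀ i j, Covers π i j → w i ≠ (w j).inv := by
  refine ⟨fun h => ⟨h.1.2.1, h.2⟩, fun h => ?_⟩
  obtain ⟨h1, h2⟩ := (labels_iff hπ w).1 h
  have hper : ∀ j, (fun j => w (pt n j)) (j + n) = (fun j => w (pt n j)) j := fun j => by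
    simp only [pt_add]
  have hcyc := (isCyclicallyReduced_freeLetters hπ.arcSystem hper).2
    fun i j hij hi hj hb => h2 i j hij hi.out hj.out hb
  have hred := reflTransGen_freeLetters hπ.arcSystem hper h1 hcyc.1
  rw [freeLetters_word hπ] at hcyc hred
  rw [segment_word] at hred
  exact ⟨⟨hπ, h.1, hcyc, hred⟩, h.2⟩

theorem isAdmissible_iff {π : Setoid (Fin n)} (hπ : IsHalfPairing π) (w : Word N n) :
    IsAdmissible w π ↔ (∀ i s, arcs π i s → w (pt n s) = (w (pt n i)).inv) ∧
      ∀ i j, i < j → Out (arcs π) i → Out (arcs π) j → Balanced (arcs π) (i + 1) j →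
        w (pt n i) ≠ (w (pt n j)).inv := by
  rw [isAdmissible_iff_labels hπ, labels_iff hπ]

end CyclicReduction

/-! ### The height of a periodic word -/

open Filter

section WordHeight

variable {N n : ℕ} {L : ℤ → Letter N}

theorem segProd_shift (hL : ∀ j, L (j + n) = L j) (a b : ℤ) :
    segProd L (a + n) (b + n) = segProd L a b := by
  rw [segProd, segProd, segment_shift hL, add_sub_add_right_eq_sub]

theorem segProd_period (hL : ∀ j, L (j + n) = L j) (c : ℕ) :
    segProd L (-(c * n)) (-(c * n) + n) = segProd L 0 n := by
  induction c with
  | zero => simp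
  | succ c ih =>
    rw [← ih, ← segProd_shift hL]
    congr 1 <;> · push_cast; ring

theorem segProd_succ {a j : ℤ} (h : a ≤ j) :
    segProd L a (j + 1) = segProd L a j * FreeGroup.mk [L j] := by
  rw [← segProd_mul L h (by omega), segProd_succ_self]

/-- The height of a periodic word which is not trivial: the distance to the point where the walk
started in the far past. -/
theorem exists_wordHeight (hn : 0 < n) (hL : ∀ j, L (j + n) = L j) (hW : segProd L 0 n ≠ 1) :
    ∃ (k : ℤ) (h : ℤ → ℤ), IsHeight n k h ∧ ∀ j, ∀ᶠ c : ℕ in atTop,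
      -((c : ℤ) * n) ≤ j ∧ ((segProd L (-(c * n)) j).norm : ℤ) = h j + k * c := by
  obtain ⟨k, hk, hT⟩ := exists_translation_length hW
  have hle : ∀ (j : ℤ) (c : ℕ), j.natAbs ≤ c → -((c : ℤ) * n) ≤ j := by
    intro j c hc
    have : (j.natAbs : ℤ) ≤ c * n := by
      have : j.natAbs ≤ c * n := hc.trans (Nat.le_mul_of_pos_right _ hn)
      exact_mod_cast this
    omega
  -- Starting `e` periods earlier multiplies the product from the left by the `e`-th power of the
  -- word, so the translation length applies.
  have hpow : ∀ (j : ℤ) (e : ℕ), segProd L (-((j.natAbs + e : ℕ) * n)) j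
      = segProd L 0 n ^ e * segProd L (-(j.natAbs * n)) j := by
    intro j e
    induction e with
    | zero => simp
    | succ e ih =>
      rw [pow_succ', mul_assoc, ← ih, ← segProd_period hL (j.natAbs + (e + 1))]
      have e1 : -(((j.natAbs + (e + 1) : ℕ) : ℤ) * n) + n = -((j.natAbs + e : ℕ) * n) := by
        push_cast
        ring
      rw [e1, segProd_mul L (by omega) (hle j _ (by omega))]
  have key : ∀ j : ℤ, ∃ C : ℕ, ∀ c ≥ C, -((c : ℤ) * n) ≤ j ∧
      (segProd L (-((c + 1 : ℕ) * n)) j).norm = (segProd L (-(c * n)) j).norm + k := by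
    intro j
    obtain ⟨C, hC⟩ := hT (segProd L (-(j.natAbs * n)) j)
    refine ⟨j.natAbs + C, fun c hc => ⟨hle j c (by omega), ?_⟩⟩
    obtain ⟨e, rfl⟩ := Nat.exists_eq_add_of_le (show j.natAbs ≤ c by omega)
    rw [add_assoc, hpow, hpow, hC e (by omega)]
  choose C hC using key
  -- `C j` is a time from which the growth is exactly `k` per period, so the value does not change
  -- if a larger `c` is used.
  let h : ℤ → ℤ := fun j => (segProd L (-(C j * n)) j).norm - k * C j
  have hh : ∀ j, ∀ c ≥ C j, ((segProd L (-(c * n)) j).norm : ℤ) = h j + k * c := by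
    intro j c hc
    induction c, hc using Nat.le_induction with
    | base => simp [h]
    | succ c hc ih =>
      rw [(hC j c hc).2]
      push_cast
      rw [ih]
      ring
  refine ⟨k, h, ⟨by exact_mod_cast hk, ?_, ?_⟩, fun j => ?_⟩
  · intro j
    set c := max (C j) (C (j + 1)) with hc
    have h1 := hh j c (le_max_left _ _)
    have h2 := hh (j + 1) c (le_max_right _ _)
    rw [segProd_succ (hC j c (le_max_left _ _)).1] at h2
    by_cases hl : (segProd L (-(c * n)) j).toWord.getLast? = some (L j).inv
    · have := norm_mul_letter_of_eq hl
      right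
      omega
    · have := norm_mul_letter_of_ne hl
      left
      omega
  · intro j
    set c := max (C j) (C (j + n)) with hc
    have h1 := hh j (c + 1) ((le_max_left _ _).trans (Nat.le_succ _))
    have h2 := hh (j + n) c (le_max_right _ _)
    -- Moving the end by `n` is the same as starting one period earlier, which costs `k`.
    have e : segProd L (-(((c + 1 : ℕ) : ℤ) * n)) j = segProd L (-(c * n)) (j + n) := by
      rw [← segProd_shift hL]
      congr 1
      push_cast
      ring
    rw [e, h2] at h1
    push_cast at h1
    linarith
  · filter_upwards [eventually_ge_atTop (C j)] with c hc
    exact ⟨(hC j c hc).1, hh j c hc⟩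

/-- The path goes up at `j` if and only if the letter at `j` does not cancel the last letter of the
walk. -/
theorem wordHeight_up_iff {k : ℤ} {h : ℤ → ℤ} (hev : ∀ j, ∀ᶠ c : ℕ in atTop,
      -((c : ℤ) * n) ≤ j ∧ ((segProd L (-(c * n)) j).norm : ℤ) = h j + k * c) (j : ℤ) :
    ∀ᶠ c : ℕ in atTop, -((c : ℤ) * n) ≤ j ∧
      (h (j + 1) = h j + 1 ↔ (segProd L (-(c * n)) j).toWord.getLast? ≠ some (L j).inv) := by
  filter_upwards [hev j, hev (j + 1)] with c h1 h2
  refine ⟨h1.1, ?_⟩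
  have h3 := h1.2
  have h4 := h2.2
  rw [segProd_succ h1.1] at h4
  by_cases hl : (segProd L (-(c * n)) j).toWord.getLast? = some (L j).inv
  · have := norm_mul_letter_of_eq hl
    refine ⟨fun h5 => ?_, fun h5 => absurd hl h5⟩
    omega
  · have := norm_mul_letter_of_ne hl
    refine ⟨fun _ => hl, fun h5 => ?_⟩
    omega

/-- After an up step at `i` and a balanced interval, the walk ends with the letter at `i`. -/
theorem getLast?_of_up {k : ℤ} {h : ℤ → ℤ} (hev : ∀ j, ∀ᶠ c : ℕ in atTop,
      -((c : ℤ) * n) ≤ j ∧ ((segProd L (-(c * n)) j).norm : ℤ) = h j + k * c) {i j : ℤ}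
    (hij : i < j) (hup : h (i + 1) = h i + 1) (h1 : segProd L (i + 1) j = 1) :
    ∀ᶠ c : ℕ in atTop, (segProd L (-(c * n)) j).toWord.getLast? = some (L i) := by
  filter_upwards [wordHeight_up_iff hev i] with c hc
  rw [← segProd_mul L (b := i + 1) (by omega) (by omega), h1, mul_one, segProd_succ hc.1,
    toWord_mul_letter_of_ne (hc.2.1 hup)]
  simp

/-- The arcs below the height of the word work. For an arc `i ⌢ s`, induction on its length makes
the product of its interior trivial, so the walk arrives at `s` with last letter `L i`; the down
step at `s` must cancel it. In the same way an up step at `j` must not cancel the letter of the out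
point visible from `j`. -/
theorem exists_admissible_arcs (hn : 0 < n) (hL : ∀ j, L (j + n) = L j)
    (hW : segProd L 0 n ≠ 1) :
    ∃ M, ArcSystem n M ∧ (∀ i s, M i s → L s = (L i).inv) ∧
      ∀ i j, i < j → Out M i → Out M j → Balanced M (i + 1) j → L i ≠ (L j).inv := by
  obtain ⟨k, h, hh, hev⟩ := exists_wordHeight hn hL hW
  have hM := hh.arcSystem
  have hpair : ∀ i s, heightArcs h i s → L s = (L i).inv := by
    intro i s his
    induction hd : (s - i).toNat using Nat.strong_induction_on generalizing i s with
    | _ d ih =>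
      have hlt := hM.lt his
      have hb := segProd_balanced hM L (by omega)
        (fun i' s' h1 h2 h3 => ih _ (by have := hM.lt h3; omega) i' s' h3 rfl)
        (hM.balanced_interior his)
      have hup : h (i + 1) = h i + 1 := by
        rw [← hh.out_iff]
        exact fun j hj => hM.not_left hj his
      have hdown : ¬ h (s + 1) = h s + 1 := by
        rw [← hh.out_iff]
        exact fun ho => ho _ his
      obtain ⟨c, h1, h2⟩ := ((getLast?_of_up hev hlt hup hb).and (wordHeight_up_iff hev s)).exists
      rw [h2.2, h1] at hdown
      simp only [ne_eq, not_not, Option.some.injEq] at hdown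
      rw [hdown, Letter.inv_inv]
  refine ⟨heightArcs h, hM, hpair, fun i j hij hi hj hb => ?_⟩
  have hb' := segProd_balanced hM L (by omega) (fun i s _ _ => hpair i s) hb
  rw [hh.out_iff] at hi hj
  obtain ⟨c, h1, h2⟩ := ((getLast?_of_up hev hij hi hb').and (wordHeight_up_iff hev j)).exists
  rw [h2.2, h1] at hj
  simpa using hj

/-- In an admissible arc system the out points are the up steps of the height. -/
theorem out_iff_of_admissible [NeZero n] {M : ℤ → ℤ → Prop} (hM : ArcSystem n M)
    (hpair : ∀ i s, M i s → L s = (L i).inv)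
    (hcov : ∀ i j, i < j → Out M i → Out M j → Balanced M (i + 1) j → L i ≠ (L j).inv)
    {k : ℤ} {h : ℤ → ℤ} (hev : ∀ j, ∀ᶠ c : ℕ in atTop,
      -((c : ℤ) * n) ≤ j ∧ ((segProd L (-(c * n)) j).norm : ℤ) = h j + k * c) (j : ℤ) :
    Out M j ↔ h (j + 1) = h j + 1 := by
  have hn : 0 < n := Nat.pos_of_neZero n
  obtain ⟨a, q, a0, aq, qn, ha, -⟩ := hM.exists_first_last_free
  have hlast : ∀ᶠ c : ℕ in atTop, ∀ i, i < j → Out M i → Balanced M (i + 1) j →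
      (segProd L (-(c * n)) j).toWord.getLast? = some (L i) := by
    -- The walk starts at `-c * n`, but the reduced word is known from the free point `a - c * n`.
    -- The piece before it has at most `a < n` letters, while for such `c` the word after it has at
    -- least `n + 1`, so cancellation cannot reach the last letter.
    filter_upwards [eventually_ge_atTop (n + 1 + a.toNat + j.natAbs)] with c hc i hij hi hb
    obtain ⟨e, rfl⟩ := Nat.exists_eq_add_of_le hc
    have hfree := hM.free_unshift_mul ha (n + 1 + a.toNat + j.natAbs + e)
    have hle : a - ((n + 1 + a.toNat + j.natAbs + e : ℕ) : ℤ) * n + (n + 1 : ℕ) * n ≤ j := by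
      have : ((a.toNat + j.natAbs + e : ℕ) : ℤ) ≤ (a.toNat + j.natAbs + e : ℕ) * n := by
        exact_mod_cast Nat.le_mul_of_pos_right _ hn
      push_cast at this ⊢
      nlinarith [Int.toNat_of_nonneg a0, neg_abs_le j]
    have hlt : a - ((n + 1 + a.toNat + j.natAbs + e : ℕ) : ℤ) * n < j := by
      have : (0 : ℤ) < (n + 1 : ℕ) * n := by positivity
      omega
    obtain ⟨T, T1, T2, T3, T4⟩ := exists_reduced_segProd hM L hpair hcov hfree hlt
    have hcount := le_freeCount hM hfree hn (n + 1) hle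
    set c := n + 1 + a.toNat + j.natAbs + e
    rw [← segProd_mul L (a := -(c * n)) (b := a - c * n) (by omega) (by omega), ← T2,
      getLast?_toWord_mul T1, T4 i hij hi hb]
    have h1 : (segProd L (-(c * n)) (a - c * n)).norm ≤ a.toNat := by
      refine FreeGroup.norm_mk_le.trans ?_
      simp [segment]
    omega
  obtain ⟨c, ⟨h1, h2⟩, h3⟩ := (hlast.and (wordHeight_up_iff hev j)).exists.imp
    fun c hc => (⟨⟨hc.1, hc.2.1⟩, hc.2.2⟩ : (_ ∧ _) ∧ _)
  rw [h3]
  constructor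
  · intro hj
    have hfree := hM.free_unshift_mul ha (1 + a.toNat + j.natAbs)
    have hlt : a - ((1 + a.toNat + j.natAbs : ℕ) : ℤ) * n < j := by
      have : ((1 + a.toNat + j.natAbs : ℕ) : ℤ) ≤ (1 + a.toNat + j.natAbs : ℕ) * n := by
        exact_mod_cast Nat.le_mul_of_pos_right _ hn
      omega
    obtain ⟨i, -, i2, i3, i4⟩ := hM.exists_top hfree hlt
    rw [h1 i i2 i3 i4]
    simpa using hcov i j i2 i3 hj i4
  · intro hne i hi
    apply hne
    rw [h1 i (hM.lt hi) (fun u hu => hM.not_left hu hi) (hM.balanced_interior hi), hpair _ _ hi,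
      Letter.inv_inv]

end WordHeight

/-! ### Existence and uniqueness of the admissible half-pairing -/

section Standard

variable {N n : ℕ}

/-- Removing the two ends is a conjugation, so triviality is preserved although the value may
change. -/
theorem CyclicStep.mk_eq_one {v v' : List (Letter N)} (h : CyclicStep v v')
    (hv : FreeGroup.mk v = 1) : FreeGroup.mk v' = 1 := by
  cases h with
  | adjacent h => rw [← hv]; exact (Quot.sound h).symm
  | ends l v =>
    rw [← List.singleton_append, ← FreeGroup.mul_mk, ← FreeGroup.mul_mk, ← invRev_singleton,
      ← FreeGroup.inv_mk, ← mul_assoc, conj_eq_one_iff] at hv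
    exact hv

/-- The word at the singletons would be reduced with trivial value, hence empty, but a half-pairing
has a singleton. -/
theorem not_isAdmissible_of_reducibleToOne {w : Word N n} (hw : ReducibleToOne w)
    (π : Setoid (Fin n)) : ¬ IsAdmissible w π := by
  rintro ⟨⟨hπ, -, hcyc, hred⟩, -⟩
  have h1 : FreeGroup.mk (List.ofFn w) = 1 := by
    rw [FreeGroup.one_eq_mk, FreeGroup.Red.exact]
    exact ⟨[], hw, FreeGroup.Red.refl⟩
  have h2 : ∀ v, Relation.ReflTransGen CyclicStep (List.ofFn w) v → FreeGroup.mk v = 1 := by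
    intro v hv
    induction hv with
    | refl => exact h1
    | tail _ h ih => exact h.mk_eq_one ih
  have h3 := toWord_mk_of_isReduced hcyc.1
  rw [h2 _ hred, FreeGroup.toWord_one] at h3
  obtain ⟨x, hx⟩ := hπ.exists_singleton
  have h4 : w x ∈ throughWord w π := List.mem_map.2 ⟨x, by simpa using hx, rfl⟩
  rw [← h3] at h4
  simp at h4

variable [NeZero n]

theorem reducibleToOne_iff {w : Word N n} :
    ReducibleToOne w ↔ segProd (fun j => w (pt n j)) 0 n = 1 := by
  have : segProd (fun j => w (pt n j)) 0 n = FreeGroup.mk (List.ofFn w) := by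
    rw [segProd, ← segment_word]
    simp
  rw [this, ReducibleToOne, FreeGroup.one_eq_mk, FreeGroup.Red.exact]
  constructor
  · exact fun h => ⟨[], h, FreeGroup.Red.refl⟩
  · rintro ⟨l, h1, h2⟩
    rw [FreeGroup.Red.nil_iff] at h2
    rwa [h2] at h1

/-- Every word that is not reducible to 1 has exactly one admissible half-pairing. -/
theorem existsUnique_isAdmissible {w : Word N n} (hw : ¬ ReducibleToOne w) :
    ∃! π : Setoid (Fin n), IsAdmissible w π := by
  have hn : 0 < n := Nat.pos_of_neZero n
  rw [reducibleToOne_iff] at hw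
  have hper : ∀ j, (fun j => w (pt n j)) (j + n) = (fun j => w (pt n j)) j := fun j => by
    simp only [pt_add]
  apply existsUnique_of_exists_of_unique
  · obtain ⟨M, hM, h1, h2⟩ := exists_admissible_arcs hn hper hw
    refine ⟨hM.toSetoid, (isAdmissible_iff hM.isHalfPairing w).2 ?_⟩
    have e : arcs hM.toSetoid = M := by
      ext i s
      exact hM.arcs_toSetoid
    rw [e]
    exact ⟨h1, h2⟩
  · intro π π' h h'
    have hπ := h.1.1
    have hπ' := h'.1.1
    obtain ⟨k, f, -, hev⟩ := exists_wordHeight hn hper hw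
    rw [isAdmissible_iff hπ] at h
    rw [isAdmissible_iff hπ'] at h'
    refine hπ.eq_of_isOut_iff hπ' fun x => ?_
    rw [← pt_coe x, ← hπ.out_iff, ← hπ'.out_iff,
      out_iff_of_admissible hπ.arcSystem h.1 h.2 hev,
      out_iff_of_admissible hπ'.arcSystem h'.1 h'.2 hev]

end Standard

/-! ### Counting the words with a given half-pairing and summing -/

section Counting

/-- If the letters of a word are chosen one after the other, and the number of the choices for each
letter does not depend on the earlier choices, then the number of words is a product. -/
theorem card_successive_choices {ι α : Type*} [Fintype ι] [DecidableEq ι] [Fintype α]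
    [Nonempty α] (ρ : ι → ℕ) (A : ι → (ι → α) → Finset α) (c : ι → ℕ)
    (hA : ∀ x y f b, ρ y ≤ ρ x → A y (Function.update f x b) = A y f)
    (hc : ∀ x f, (A x f).card = c x) [DecidablePred fun f : ι → α => ∀ x, f x ∈ A x f] :
    (Finset.univ.filter fun f : ι → α => ∀ x, f x ∈ A x f).card = ∏ x, c x := by
  classical
  -- Only the choices at points of `S` are imposed, on functions that are still defined everywhere;
  -- the factor `Fintype.card α ^ S.card` states the expected proportion without division. Points
  -- enter in order of increasing `ρ`.
  have key : ∀ S : Finset ι, (Finset.univ.filter fun f : ι → α => ∀ x ∈ S, f x ∈ A x f).card *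
      Fintype.card α ^ S.card = (∏ x ∈ S, c x) * Fintype.card (ι → α) := by
    intro S
    induction S using Finset.induction_on_max_value ρ with
    | empty => simp
    | insert x S hx hmax ih =>
      set F := Finset.univ.filter fun f : ι → α => ∀ y ∈ S, f y ∈ A y f with hF
      have hupd : ∀ f b, (∀ y ∈ S, Function.update f x b y ∈ A y (Function.update f x b)) ↔
          ∀ y ∈ S, f y ∈ A y f := by
        intro f b
        refine forall₂_congr fun y hy => ?_
        rw [hA x y f b (hmax y hy), Function.update_of_ne]
        rintro rfl
        exact hx hy
      have h1 : (Finset.univ.filter fun f : ι → α => ∀ y ∈ insert x S, f y ∈ A y f).card *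
          Fintype.card α = F.card * c x := by
        rw [← Finset.card_univ (α := α), ← Finset.card_product]
        have h2 : F.card * c x = (F.sigma fun f => A x f).card := by
          rw [Finset.card_sigma, Finset.sum_congr rfl fun f _ => hc x f]
          simp
        rw [h2]
        -- The bijection exchanges the value at `x` with the extra letter. Neither `A x` nor the
        -- conditions at earlier points see the value at `x`.
        refine Finset.card_bij' (fun p _ => ⟨Function.update p.1 x p.2, p.1 x⟩)
          (fun q _ => (Function.update q.1 x q.2, q.1 x)) ?_ ?_ ?_ ?_
        · rintro ⟨f, b⟩ hf
          simp only [Finset.mem_product, Finset.mem_filter, Finset.mem_univ, true_and, and_true,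
            Finset.forall_mem_insert] at hf
          simp only [hF, Finset.mem_sigma, Finset.mem_filter, Finset.mem_univ, true_and]
          rw [hupd, hA x x f b le_rfl]
          exact ⟨hf.2, hf.1⟩
        · rintro ⟨f, b⟩ hf
          simp only [hF, Finset.mem_sigma, Finset.mem_filter, Finset.mem_univ, true_and] at hf
          simp only [Finset.mem_product, Finset.mem_filter, Finset.mem_univ, true_and, and_true,
            Finset.forall_mem_insert]
          rw [hupd, hA x x f b le_rfl, Function.update_self]
          exact ⟨hf.2, hf.1⟩
        · rintro ⟨f, b⟩ _
          simp
        · rintro ⟨f, b⟩ _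
          simp
      rw [Finset.card_insert_of_notMem hx, pow_succ', ← mul_assoc, h1, mul_right_comm, ih,
        Finset.prod_insert hx]
      ring
  have h := key Finset.univ
  simp only [Finset.mem_univ, forall_true_left, Finset.card_univ, Fintype.card_fun] at h
  refine Nat.eq_of_mul_eq_mul_right (Nat.pos_of_ne_zero ?_) (Eq.trans ?_ h)
  · positivity
  · congr!

theorem exists_map_eq_of_nodup {α β : Type*} [Nonempty β] {l : List α} (hl : l.Nodup)
    {v : List β} (h : v.length = l.length) : ∃ b : α → β, l.map b = v := by
  classical
  induction l generalizing v with
  | nil =>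
    rw [List.length_nil, List.length_eq_zero_iff] at h
    exact ⟨fun _ => Classical.arbitrary β, by simp [h]⟩
  | cons a l ih =>
    cases v with
    | nil => simp at h
    | cons c v =>
      rw [List.nodup_cons] at hl
      obtain ⟨b, hb⟩ := ih hl.2 (v := v) (by simpa using h)
      refine ⟨Function.update b a c, ?_⟩
      rw [List.map_cons, Function.update_self, ← hb]
      congr 1
      refine List.map_congr_left fun y hy => Function.update_of_ne ?_ _ _
      rintro rfl
      exact hl.1 hy

variable {N n : ℕ}

theorem IsHalfPairing.mate_unique {π : Setoid (Fin n)} (hπ : IsHalfPairing π) {x y z : Fin n}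
    (hy : y ≠ x) (hz : z ≠ x) (hxy : π x y) (hxz : π x z) : y = z := by
  rcases hπ.card_le_two x y z hxy hxz with h | h | h
  · exact absurd h.symm hy
  · exact absurd h.symm hz
  · exact h

theorem exists_mate {π : Setoid (Fin n)} {x : Fin n} (hx : ¬ IsSingleton π x) : ∃ y, y ≠ x ∧ π x y := by
  simp only [IsSingleton, not_forall] at hx
  obtain ⟨y, h1, h2⟩ := hx
  exact ⟨y, h2, h1⟩

theorem standardReduction_of_reducibleToOne {w : Word N n} (h : ReducibleToOne w) :
    standardReduction w = [] := by
  rw [standardReduction, dif_neg]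
  rintro ⟨π, hπ⟩
  exact not_isAdmissible_of_reducibleToOne h π hπ

variable [NeZero n]

namespace IsHalfPairing

variable {π : Setoid (Fin n)} (hπ : IsHalfPairing π)

include hπ

/-- Exactly one point of each pair has the out orientation. -/
theorem isOut_iff_not_isOut {r s : Fin n} (hrs : r ≠ s) (h : π r s) : IsOut π r ↔ ¬ IsOut π s := by
  obtain ⟨t, t1, t2, rfl⟩ := exists_lift_of_ne (i := ((r : ℕ) : ℤ)) (x := s)
    (by rw [pt_coe]; exact hrs.symm)
  rw [← pt_coe r] at h ⊢
  rcases hπ.arcs_or_arcs t1 t2 h with h1 | h1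
  · rw [← hπ.out_iff, ← hπ.out_iff]
    exact ⟨fun _ ho => ho _ h1, fun _ u hu => hπ.arcSystem.not_left hu h1⟩
  · rw [← pt_add (r : ℤ), ← hπ.out_iff, ← hπ.out_iff]
    exact ⟨fun ho => absurd h1 (ho _),
      fun hno => absurd (fun u hu => hπ.arcSystem.not_left hu h1) hno⟩

/-- Only a singleton covers a singleton. -/
theorem isSingleton_of_covers {x y : Fin n} (h : Covers π x y) (hy : IsSingleton π y) :
    IsSingleton π x := by
  have hM := hπ.arcSystem
  obtain ⟨j, j1, j2, rfl⟩ := exists_lift (((x : ℕ) : ℤ) + 1) y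
  rw [← pt_coe x] at h ⊢
  obtain ⟨h3, h4, h5⟩ := (hπ.covers_iff (by omega) (by omega)).1 h
  rw [← hπ.free_iff] at hy ⊢
  refine fun s => ⟨fun hs => ?_, h3 s⟩
  have h6 := hM.lt hs
  rcases lt_or_ge s j with h7 | h7
  · obtain ⟨u, u1, u2, u3⟩ := h5 s (by omega) h7
    have := hM.joined_unique u3 (Or.inr hs)
    omega
  · exact hM.not_free_of_arc hs (by omega) h7 hy

/-- At a singleton the covering condition is part of cyclic reducedness of the word at the
singletons, so it imposes nothing further once that word is fixed. -/
theorem ne_inv_of_covers {w : Word N n}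
    (hcyc : FreeGroup.IsCyclicallyReduced (throughWord w π)) {x y : Fin n} (h : Covers π x y)
    (hy : IsSingleton π y) : w x ≠ (w y).inv := by
  have hx := hπ.isSingleton_of_covers h hy
  rw [← freeLetters_word hπ, isCyclicallyReduced_freeLetters hπ.arcSystem
    fun j => by simp only [pt_add]] at hcyc
  obtain ⟨j, j1, j2, rfl⟩ := exists_lift (((x : ℕ) : ℤ) + 1) y
  rw [← pt_coe x] at h hx ⊢
  obtain ⟨h3, h4, h5⟩ := (hπ.covers_iff (by omega) (by omega)).1 h
  exact hcyc _ _ (by omega) (hπ.free_iff.2 hx) (hπ.free_iff.2 hy) h5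

/-- Starting from a singleton, the points can be visited in an order such that the letter at each
point which is not a singleton is restricted only by the letter at an earlier point: the point by
which it is covered, or the point with which it is paired. -/
theorem exists_predecessor : ∃ (ρ : Fin n → ℕ) (g : Fin n → Fin n), ∀ x, ¬ IsSingleton π x →
    ρ (g x) < ρ x ∧ (IsOut π x → Covers π (g x) x ∧ ∀ z, Covers π z x → z = g x) ∧
      (¬ IsOut π x → g x ≠ x ∧ π x (g x)) := by
  have hM := hπ.arcSystem
  obtain ⟨a, ha⟩ := hM.exists_free
  choose f f1 f2 f3 using fun x : Fin n => exists_lift a x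
  have hρ : ∀ t, a ≤ t → t < a + n → f (pt n t) = t := fun t t1 t2 =>
    eq_of_pt_eq (f3 _) (by have := f2 (pt n t); omega) (by have := f1 (pt n t); omega)
  suffices h : ∀ x, ∃ y, ¬ IsSingleton π x → (f y - a).toNat < (f x - a).toNat ∧
      (IsOut π x → Covers π y x ∧ ∀ z, Covers π z x → z = y) ∧ (¬ IsOut π x → y ≠ x ∧ π x y) by
    choose g hg using h
    exact ⟨fun x => (f x - a).toNat, g, hg⟩
  -- Points are ordered by their lifts to `[a, a + n)`, where `a` is free. The predecessor of an out
  -- point is the out point visible from it, that of any other point is the left end of its arc;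
  -- both lie in this window because no arc passes over `a`.
  intro x
  by_cases hx : IsSingleton π x
  · exact ⟨x, fun h => absurd hx h⟩
  have f1x := f1 x
  have f2x := f2 x
  have hax : a < f x := by
    refine lt_of_le_of_ne f1x fun h => hx ?_
    rw [← f3 x, ← hπ.free_iff, ← h]
    exact ha
  by_cases ho : IsOut π x
  · obtain ⟨i, i1, i2, i3, i4⟩ := hM.exists_top ha hax
    refine ⟨pt n i, fun _ => ⟨?_, fun _ => ⟨?_, fun z hz => ?_⟩, fun h => absurd ho h⟩⟩
    · rw [hρ i i1 (by omega)]
      omega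
    · rw [← f3 x, hπ.covers_iff i2 (by omega), hπ.out_iff, hπ.out_iff, f3, ← hπ.out_iff]
      exact ⟨i3, ho, i4⟩
    · obtain ⟨j, j1, j2, rfl⟩ := exists_lift (f x - n) z
      rw [← f3 x, hπ.covers_iff (by omega) (by omega)] at hz
      rw [hM.top_unique (by omega) i2 hz.1 i3 hz.2.2 i4]
  · obtain ⟨i, hi⟩ : ∃ i, arcs π i (f x) := by
      rw [← f3 x, ← hπ.out_iff] at ho
      simpa [Out] using ho
    have hlt := hM.lt hi
    have hai : a < i := by
      by_contra hcon
      exact hM.not_free_of_arc hi (by omega) hax.le ha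
    refine ⟨pt n i, fun _ => ⟨?_, fun h => absurd h ho, fun _ => ⟨?_, ?_⟩⟩⟩
    · rw [hρ i hai.le (by omega)]
      omega
    · have := pt_ne_of_lt hi.1 hi.2.1
      rwa [f3] at this
    · have := π.symm' hi.2.2.1
      rwa [f3] at this

open Classical in
/-- The points of the pairs which have the out orientation are as many as those which do not. -/
theorem card_out_paired : (Finset.univ.filter fun x => IsOut π x ∧ ¬ IsSingleton π x).card =
    (Finset.univ.filter fun x => ¬ IsOut π x).card := by
  have hns : ∀ x, ¬ IsOut π x → ¬ IsSingleton π x := fun x h h' => h (Or.inl h')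
  have hmate : ∀ x, ∃ y, ¬ IsSingleton π x → y ≠ x ∧ π x y := fun x => by
    by_cases hx : IsSingleton π x
    · exact ⟨x, fun h => absurd hx h⟩
    · obtain ⟨y, hy⟩ := exists_mate hx
      exact ⟨y, fun _ => hy⟩
  choose g hg using hmate
  have hgs : ∀ x, ¬ IsSingleton π x → ¬ IsSingleton π (g x) := fun x hx h =>
    (hg x hx).1 (h _ (π.symm' (hg x hx).2)).symm
  have hgg : ∀ x, ¬ IsSingleton π x → g (g x) = x := fun x hx =>
    hπ.mate_unique (hg _ (hgs x hx)).1 (hg x hx).1.symm (hg _ (hgs x hx)).2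
      (π.symm' (hg x hx).2)
  refine Finset.card_bij' (fun x _ => g x) (fun x _ => g x) ?_ ?_ ?_ ?_
  · intro x hx
    simp only [Finset.mem_filter, Finset.mem_univ, true_and] at hx ⊢
    exact (hπ.isOut_iff_not_isOut (hg x hx.2).1.symm (hg x hx.2).2).1 hx.1
  · intro x hx
    simp only [Finset.mem_filter, Finset.mem_univ, true_and] at hx ⊢
    have h := hns x hx
    exact ⟨(hπ.isOut_iff_not_isOut (hg x h).1 (π.symm' (hg x h).2)).2 hx, hgs x h⟩
  · intro x hx
    simp only [Finset.mem_filter, Finset.mem_univ, true_and] at hx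
    exact hgg x hx.2
  · intro x hx
    simp only [Finset.mem_filter, Finset.mem_univ, true_and] at hx
    exact hgg x (hns x hx)

open Classical in
theorem length_singletons_add : ((List.finRange n).filter fun x => IsSingleton π x).length +
    2 * (Finset.univ.filter fun x => ¬ IsOut π x).card = n := by
  have h1 : ((List.finRange n).filter fun x => IsSingleton π x).length =
      (Finset.univ.filter fun x => IsSingleton π x).card := by
    rw [← List.toFinset_card_of_nodup ((List.nodup_finRange n).filter _)]
    congr 1
    ext x
    simp
  have h2 : (Finset.univ.filter fun x => IsOut π x).card =
      (Finset.univ.filter fun x => IsSingleton π x).card +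
        (Finset.univ.filter fun x => IsOut π x ∧ ¬ IsSingleton π x).card := by
    rw [← Finset.card_filter_add_card_filter_not (s := Finset.univ.filter fun x => IsOut π x)
      (fun x => IsSingleton π x), Finset.filter_filter, Finset.filter_filter]
    congr 2
    ext x
    simp only [Finset.mem_filter, Finset.mem_univ, true_and]
    exact ⟨fun h => h.2, fun h => ⟨Or.inl h, h⟩⟩
  have h3 := Finset.card_filter_add_card_filter_not (s := (Finset.univ : Finset (Fin n)))
    (fun x => IsOut π x)
  rw [Finset.card_univ, Fintype.card_fin] at h3
  rw [hπ.card_out_paired] at h2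
  omega

open Classical in
/-- The number of words with a given admissible half-pairing and given letters at its singletons. -/
theorem card_admissible {v : List (Letter N)} (hv : FreeGroup.IsCyclicallyReduced v)
    (hlen : v.length = ((List.finRange n).filter fun x => IsSingleton π x).length) :
    (Finset.univ.filter fun w : Word N n => IsAdmissible w π ∧ throughWord w π = v).card =
      (2 * N - 1) ^ (Finset.univ.filter fun x => ¬ IsOut π x).card := by
  obtain ⟨x₀, hx₀⟩ := hπ.exists_singleton
  -- The singleton makes `v` nonempty, which supplies a letter and rules out `N = 0`.
  have : Nonempty (Letter N) := by
    have h1 : 0 < v.length := by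
      rw [hlen, List.length_pos_iff_exists_mem]
      exact ⟨x₀, by simpa using hx₀⟩
    obtain ⟨l, -⟩ := List.length_pos_iff_exists_mem.1 h1
    exact ⟨l⟩
  obtain ⟨b, hb⟩ := exists_map_eq_of_nodup
    ((List.nodup_finRange n).filter fun x => decide (IsSingleton π x)) hlen
  have hthrough : ∀ w : Word N n, throughWord w π = v ↔ ∀ x, IsSingleton π x → w x = b x := by
    intro w
    rw [← hb, throughWord, List.map_inj_left]
    simp
  obtain ⟨ρ, g, hg⟩ := hπ.exists_predecessor
  -- Singletons are prescribed by `v`, out points of pairs avoid the inverse of the covering letter,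
  -- and the remaining points carry the inverse of their partner's letter.
  let A : Fin n → Word N n → Finset (Letter N) := fun x w =>
    if IsSingleton π x then {b x} else if IsOut π x then {(w (g x)).inv}ᶜ else {(w (g x)).inv}
  have hset : (Finset.univ.filter fun w : Word N n => IsAdmissible w π ∧ throughWord w π = v) =
      Finset.univ.filter fun w : Word N n => ∀ x, w x ∈ A x w := by
    ext w
    simp only [Finset.mem_filter, Finset.mem_univ, true_and]
    constructor
    · rintro ⟨hadm, hw⟩ x
      rw [hthrough] at hw
      rw [isAdmissible_iff_labels hπ] at hadm
      simp only [A]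
      split_ifs with h1 h2
      · simpa using hw x h1
      · simpa using Letter.ne_inv_comm.1 (hadm.2 _ _ ((hg x h1).2.1 h2).1)
      · obtain ⟨h3, h4⟩ := (hg x h1).2.2 h2
        simpa using hadm.1 _ _ h3.symm h4
    · intro hw
      have hvw : throughWord w π = v := by
        rw [hthrough]
        intro x hx
        have := hw x
        simpa [A, hx] using this
      refine ⟨(isAdmissible_iff_labels hπ w).2 ⟨?_, ?_⟩, hvw⟩
      · have hin : ∀ r s, r ≠ s → π r s → ¬ IsOut π s → w s = (w r).inv := by
          intro r s hrs h hs
          have hs' : ¬ IsSingleton π s := fun h' => hs (Or.inl h')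
          obtain ⟨h3, h4⟩ := (hg s hs').2.2 hs
          have := hw s
          simp only [A, hs', hs, if_false, Finset.mem_singleton] at this
          rw [this, hπ.mate_unique h3 hrs h4 (π.symm' h)]
        intro r s hrs h
        by_cases hs : IsOut π s
        · have hr : ¬ IsOut π r := (hπ.isOut_iff_not_isOut hrs.symm (π.symm' h)).1 hs
          exact hin s r hrs.symm (π.symm' h) hr
        · rw [hin r s hrs h hs, Letter.inv_inv]
      · intro i j hij
        by_cases hj : IsSingleton π j
        · exact hπ.ne_inv_of_covers (by rw [hvw]; exact hv) hij hj
        · have ho : IsOut π j := hij.2.1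
          have := hw j
          simp only [A, hj, ho, if_false, if_true, Finset.mem_compl, Finset.mem_singleton] at this
          rw [← ((hg j hj).2.1 ho).2 i hij] at this
          exact Letter.ne_inv_comm.1 this
  rw [hset, card_successive_choices ρ A
    (fun x => if IsOut π x ∧ ¬ IsSingleton π x then 2 * N - 1 else 1)]
  · rw [Finset.prod_ite]
    simp only [Finset.prod_const, one_pow, mul_one]
    rw [← hπ.card_out_paired]
  · intro x y f c hyx
    simp only [A]
    split_ifs with h1 h2
    · rfl
    all_goals
      rw [Function.update_of_ne]
      rintro h
      have := (hg y h1).1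
      rw [h] at this
      omega
  · intro x f
    simp only [A]
    by_cases h1 : IsSingleton π x
    · simp [h1]
    · by_cases h2 : IsOut π x
      · simp only [h1, h2, if_true, if_false, Finset.card_compl, Finset.card_singleton,
          Fintype.card_prod, Fintype.card_fin, Fintype.card_bool, not_false_eq_true, and_self]
        rw [mul_comm]
      · simp [h1, h2]

open Classical in
-- Group the words by their letters at the singletons: by `card_admissible` every cyclically reduced
-- word of the right length occurs equally often.
theorem sum_admissible : (∑ w : Word N n with IsAdmissible w π, wordElem (throughWord w π)) =
    (((2 * N - 1) ^ (Finset.univ.filter fun x => ¬ IsOut π x).card : ℕ) : ℂ) •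
      Q N (n - 2 * (Finset.univ.filter fun x => ¬ IsOut π x).card) := by
  set l := (List.finRange n).filter fun x => IsSingleton π x with hl
  have hk : n - 2 * (Finset.univ.filter fun x => ¬ IsOut π x).card = l.length := by
    have := hπ.length_singletons_add
    rw [← hl] at this
    omega
  let T : Word N n → Word N l.length := fun w t => w (l.get t)
  have hT : ∀ w, List.ofFn (T w) = throughWord w π := by
    intro w
    rw [throughWord, ← hl]
    conv_rhs => rw [← List.ofFn_get l, List.map_ofFn]
    rfl
  rw [hk, Q, Finset.smul_sum]
  rw [← Finset.sum_fiberwise_of_maps_to (g := T)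
    (t := Finset.univ.filter fun v : Word N l.length =>
      FreeGroup.IsCyclicallyReduced (List.ofFn v))]
  · refine Finset.sum_congr rfl fun v hv => ?_
    simp only [Finset.mem_filter, Finset.mem_univ, true_and] at hv
    rw [← hπ.card_admissible hv (by simp [hl]), Finset.filter_filter]
    have h1 : ∀ w, T w = v ↔ throughWord w π = List.ofFn v := by
      intro w
      rw [← hT, List.ofFn_injective.eq_iff]
    simp only [h1]
    rw [Nat.cast_smul_eq_nsmul, ← Finset.sum_const]
    refine Finset.sum_congr rfl fun w hw => ?_
    simp only [Finset.mem_filter, Finset.mem_univ, true_and] at hw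
    rw [hw.2]
  · intro w hw
    simp only [Finset.mem_filter, Finset.mem_univ, true_and] at hw ⊢
    rw [hT]
    exact hw.1.2.2.1

end IsHalfPairing

theorem standardReduction_eq {w : Word N n} {π : Setoid (Fin n)} (h : IsAdmissible w π) :
    standardReduction w = throughWord w π := by
  have hw : ¬ ReducibleToOne w := fun hw => not_isAdmissible_of_reducibleToOne hw π h
  have hex : ∃ π : Setoid (Fin n), IsAdmissible w π := ⟨π, h⟩
  rw [standardReduction, dif_pos hex, (existsUnique_isAdmissible hw).unique hex.choose_spec h]

/-- The coefficients of the standard cyclic reduction of `x ^ n`. -/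
theorem xPowHat_eq : xPowHat N n = (s N n 0 : ℂ) • 1 +
    ∑ m ∈ Finset.range ((n + 1) / 2),
      (((2 * N - 1) ^ m * n.choose m : ℕ) : ℂ) • Q N (n - 2 * m) := by
  classical
  -- `P I` is the half-pairing with non-out points `I`. For large `I` the value `⊥` is a dummy that
  -- never enters the sum.
  have hex : ∀ I : Finset (Fin n), ∃ π : Setoid (Fin n), 2 * I.card < n →
      IsHalfPairing π ∧ ∀ x, IsOut π x ↔ x ∉ I := by
    intro I
    by_cases hI : 2 * I.card < n
    · obtain ⟨π, hπ⟩ := exists_halfPairing hI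
      exact ⟨π, fun _ => hπ⟩
    · exact ⟨⊥, fun h => absurd h hI⟩
  choose P hP using hex
  -- For a word not reducible to 1, exactly one `I` contributes: the set of non-out points of its
  -- admissible half-pairing.
  have hword : ∀ w : Word N n, wordElem (standardReduction w) =
      (if ReducibleToOne w then 1 else 0) +
        ∑ I : Finset (Fin n) with 2 * I.card < n,
          if IsAdmissible w (P I) then wordElem (throughWord w (P I)) else 0 := by
    intro w
    by_cases hw : ReducibleToOne w
    · rw [standardReduction_of_reducibleToOne hw, if_pos hw, Finset.sum_eq_zero, add_zero]
      · rw [wordElem, ← FreeGroup.one_eq_mk, map_one]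
      · intro I _
        rw [if_neg (not_isAdmissible_of_reducibleToOne hw _)]
    · obtain ⟨π, hπ, huniq⟩ := existsUnique_isAdmissible hw
      have hhalf := hπ.1.1
      set I₀ := Finset.univ.filter fun x => ¬ IsOut π x with hI₀
      have hlen : ((List.finRange n).filter fun x => IsSingleton π x).length + 2 * I₀.card = n := by
        convert hhalf.length_singletons_add
      have hI₀' : 2 * I₀.card < n := by
        obtain ⟨x, hx⟩ := hhalf.exists_singleton
        have : 0 < ((List.finRange n).filter fun x => IsSingleton π x).length := by
          rw [List.length_pos_iff_exists_mem]
          exact ⟨x, by simpa using hx⟩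
        omega
      have hPI₀ : P I₀ = π := by
        refine (hP I₀ hI₀').1.eq_of_isOut_iff hhalf fun x => ?_
        rw [(hP I₀ hI₀').2]
        simp [hI₀]
      rw [if_neg hw, zero_add, Finset.sum_eq_single I₀, hPI₀, if_pos hπ, standardReduction_eq hπ]
      · intro I hI hne
        rw [if_neg]
        intro hadm
        apply hne
        have h1 := huniq _ hadm
        simp only [Finset.mem_filter, Finset.mem_univ, true_and] at hI
        ext x
        have h2 := (hP I hI).2 x
        rw [h1] at h2
        simp [hI₀, h2]
      · intro h
        simp [hI₀'] at h
  have hsum : ∀ I : Finset (Fin n), 2 * I.card < n →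
      (∑ w : Word N n, if IsAdmissible w (P I) then wordElem (throughWord w (P I)) else 0) =
        (((2 * N - 1) ^ I.card : ℕ) : ℂ) • Q N (n - 2 * I.card) := by
    intro I hI
    have hI' : (Finset.univ.filter fun x => ¬ IsOut (P I) x) = I := by
      ext x
      simp [(hP I hI).2]
    rw [← Finset.sum_filter, (hP I hI).1.sum_admissible, hI']
  rw [xPowHat, Finset.sum_congr rfl fun w _ => hword w, Finset.sum_add_distrib]
  congr 1
  · rw [← Finset.sum_filter, Finset.sum_const, s, if_pos rfl, Nat.cast_smul_eq_nsmul]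
  · rw [Finset.sum_comm, Finset.sum_congr rfl fun I hI => hsum I (Finset.mem_filter.1 hI).2,
      Finset.sum_filter]
    -- The summand depends only on `I.card`, so each `m` with `2 * m < n` occurs `n.choose m` times.
    have h1 := Finset.sum_powerset_apply_card
      (fun m => if 2 * m < n then (((2 * N - 1) ^ m : ℕ) : ℂ) • Q N (n - 2 * m) else 0)
      (x := (Finset.univ : Finset (Fin n)))
    rw [Finset.powerset_univ, Finset.card_univ, Fintype.card_fin] at h1
    rw [h1]
    symm
    refine Finset.sum_subset_zero_on_sdiff ?_ ?_ ?_
    · intro m hm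
      simp only [Finset.mem_range] at hm ⊢
      omega
    · intro m hm
      simp only [Finset.mem_sdiff, Finset.mem_range] at hm
      rw [if_neg (by omega), smul_zero]
    · intro m hm
      simp only [Finset.mem_range] at hm
      rw [if_pos (by omega), ← Nat.cast_smul_eq_nsmul ℂ, smul_smul, ← Nat.cast_mul, mul_comm]

end Counting

/-! ### Expansion of the power and the final form of the coefficients -/

section Expansion

variable {N : ℕ}

theorem x_eq_sum : x N = ∑ l : Letter N, wordElem [l] := by
  rw [x, Fintype.sum_prod_type]
  refine Finset.sum_congr rfl fun i _ => ?_
  rw [Fintype.sum_bool]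
  rfl

theorem x_pow (n : ℕ) : x N ^ n = ∑ w : Word N n, wordElem (List.ofFn w) := by
  induction n with
  | zero => simp [wordElem, ← FreeGroup.one_eq_mk, MonoidAlgebra.one_def]
  | succ n ih =>
    rw [pow_succ', ih, x_eq_sum, Finset.sum_mul_sum, ← Fintype.sum_prod_type',
      ← (Fin.consEquiv fun _ : Fin (n + 1) => Letter N).sum_comp]
    refine Finset.sum_congr rfl fun p _ => ?_
    simp only [Fin.consEquiv, Equiv.coe_fn_mk, List.ofFn_cons]
    rw [wordElem, wordElem, wordElem, ← map_mul, FreeGroup.mul_mk, List.singleton_append]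

theorem s_sub {n j : ℕ} (h : 2 * j < n) : s N n (n - 2 * j) = (2 * N - 1) ^ j * n.choose j := by
  have e : n - (n - 2 * j) = 2 * j := by omega
  rw [s, if_neg (by omega), e, if_pos ⟨by omega, even_two_mul j⟩, Nat.mul_div_cancel_left _ two_pos]

/-- Each removal deletes two letters, so only words of even length reduce to the empty word. -/
theorem s_zero_of_odd {n : ℕ} (hn : Odd n) : s N n 0 = 0 := by
  classical
  rw [s, if_pos rfl, Finset.card_eq_zero, Finset.filter_eq_empty_iff]
  intro w _ hw
  obtain ⟨m, hm⟩ := FreeGroup.Red.length hw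
  rw [List.length_ofFn] at hm
  rw [hm, List.length_nil, zero_add] at hn
  exact Nat.not_even_iff_odd.2 hn (even_two_mul m)

/-- Both parities at once: the term `m = 0` has coefficient 1 and is split off as the leading one.
-/
theorem xPowHat_eq_add {n : ℕ} (hn : 0 < n) : xPowHat N n = Q N n
    + ∑ j ∈ Finset.Icc 1 ((n + 1) / 2 - 1), (s N n (n - 2 * j) : ℂ) • Q N (n - 2 * j)
    + (s N n 0 : ℂ) • (1 : MonoidAlgebra ℂ (FreeGroup (Fin N))) := by
  have : NeZero n := ⟨hn.ne'⟩
  rw [xPowHat_eq, add_comm]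
  congr 1
  rw [Finset.range_eq_Ico, Finset.sum_eq_sum_Ico_succ_bot (by omega)]
  congr 1
  · simp
  · refine Finset.sum_congr ?_ fun j hj => ?_
    · ext j
      simp only [Finset.mem_Ico, Finset.mem_Icc]
      omega
    · rw [Finset.mem_Icc] at hj
      rw [s_sub (by omega)]

end Expansion

end FreeCycle

theorem mainTheorem6 (N n : ℕ) (hn : 0 < n) :
    -- the standard cyclic reduction is well defined
    (∀ w : FreeCycle.Word N n, ¬ FreeCycle.ReducibleToOne w →
      ∃! π : Setoid (Fin n), FreeCycle.IsAdmissible w π) ∧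
    -- the expansion of `x ^ n`
    FreeCycle.x N ^ n = ∑ w : FreeCycle.Word N n, FreeCycle.wordElem (List.ofFn w) ∧
    (Even n →
      FreeCycle.xPowHat N n = FreeCycle.Q N n
        + ∑ j ∈ Finset.Icc 1 (n / 2 - 1),
            (FreeCycle.s N n (n - 2 * j) : ℂ) • FreeCycle.Q N (n - 2 * j)
        + (FreeCycle.s N n 0 : ℂ) • (1 : MonoidAlgebra ℂ (FreeGroup (Fin N)))) ∧
    (Odd n →
      FreeCycle.xPowHat N n = FreeCycle.Q N n
        + ∑ j ∈ Finset.Icc 1 ((n - 1) / 2),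
            (FreeCycle.s N n (n - 2 * j) : ℂ) • FreeCycle.Q N (n - 2 * j)) := by

  have : NeZero n := ⟨hn.ne'⟩
  refine ⟨fun w hw => FreeCycle.existsUnique_isAdmissible hw, FreeCycle.x_pow n, fun he => ?_,
    fun ho => ?_⟩
  -- For `n = 2`, and in the odd case for `n = 1`, the range of summation is empty, which gives the
  -- two exceptional formulas.
  · rw [FreeCycle.xPowHat_eq_add hn, show (n + 1) / 2 - 1 = n / 2 - 1 by grind]
  · rw [FreeCycle.xPowHat_eq_add hn, FreeCycle.s_zero_of_odd ho, Nat.cast_zero, zero_smul,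
      add_zero, show (n + 1) / 2 - 1 = (n - 1) / 2 by grind]
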